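/- Fix a set $AP$ of atomic propositions containing a distinguished proposition $\mathit{turn}$. A Markov decision process (MDP) $G=(S,A,\mathrm{mov},\delta,[\cdot])$ consists of a countable set $S$ of states, a finite set $A$ of actions, a map $\mathrm{mov}$ assigning to each state a nonempty set of available actions, a probability distribution $\delta(s,a)$ on $S$ for each $s\in S$, $a\in A$, and a label $[s]\subseteq AP$ for each $s \in S$. Let $\mathrm{dest}(s,a)$ be the support of $\delta(s,a)$. $G$ is finite if $S$ is finite, infinite if $S$ is infinite, and finitely-branching if $\mathrm{dest}(s,a)$ is finite for all $s\in S$ and $a\in\mathrm{mov}(s)$. $G$ is alternating (an AMDP) if $S$ is partitioned into $S_1$ and $S_p$ (possibly empty) such that for $s\in S_1$ we have $\mathit{turn}\in[s]$ and $|\mathrm{dest}(s,a)|=1$ for all $a\in\mathrm{mov}(s)$, and for $s\in S_p$ we have $\mathit{turn}\notin[s]$ and $|\mathrm{mov}(s)|=1$. A player-1 strategy $\sigma$ maps each history $s_0\dots s_n$ to a probability distribution on $A$ supported in $\mathrm{mov}(s_n)$. A player-$p$ strategy $\tau$ maps each history $s_0\dots s_n$ and action $a$ to a probability distribution on $S$,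 supported in $\mathrm{dest}(s_n,a)$ if $a\in\mathrm{mov}(s_n)$. $\mathrm{Outcome}(s,\sigma,\tau)$ is the set of plays $s_0s_1\cdots\in S^\omega$ with $s_0=s$ such that for every $k$ there is $a\in\mathrm{mov}(s_k)$ with $\sigma(s_0\dots s_k)(a)>0$ and $\tau(s_0\dots s_k,a)(s_{k+1})>0$. $\Pr_s^\sigma$ is the probability measure on $S^\omega$ of the play that starts at $s$, where actions are chosen by $\sigma$ and, after history $s_0\dots s_n$ and action $a$, the next state has distribution $\delta(s_n,a)$. State formulas over a set of path quantifiers are generated by $$\psi ::= \mathrm{true}\mid q\mid\neg\psi\mid\psi\vee\psi\mid Q(\phi),\qquad \phi ::= \psi\mid\bigcirc\psi\mid\psi\,\mathcal U\,\psi\mid\psi\,\mathcal W\,\psi,$$ where $q\in AP$ and $Q$ is a path quantifier. A play $s_0s_1\cdots$ satisfies a state formula $\psi$ iff $s_0\models\psi$; it satisfies $\bigcirc\psi$ iff $s_1\models\psi$; it satisfies $\psi_1\mathcal U\psi_2$ iff for some $j$, $s_j\models\psi_2$ and $s_i\models\psi_1$ for all $i<j$; it satisfies $\psi_1\mathcal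 W\psi_2$ iff either $s_j\models\psi_1$ for all $j$, or for some $j$, $s_j\models\psi_2$ and $s_i\models\psi_1$ for all $i\le j$. Let $[\![\phi]\!]$ be the set of plays that satisfy $\phi$. A state $s$ satisfies $q$ iff $q\in[s]$, the Boolean connectives have their usual meaning, and * $s\models\exists^{pos}\phi$ (resp. $\forall^{pos}\phi$) iff $\Pr_s^\sigma([\![\phi]\!])>0$ for some (resp. every) player-1 strategy $\sigma$; * $s\models\langle\!\langle 1\rangle\!\rangle\phi$, $\langle\!\langle p\rangle\!\rangle\phi$, $\langle\!\langle 1,p\rangle\!\rangle\phi$, $\langle\!\langle\emptyset\rangle\!\rangle\phi$ iff $\mathrm{Outcome}(s,\sigma,\tau)\subseteq[\![\phi]\!]$ holds for, respectively, $\exists\sigma\forall\tau$, $\exists\tau\forall\sigma$, $\exists\sigma\exists\tau$, $\forall\sigma\forall\tau$. Two states of $G$ are related by $\approx^{pos}$ if they satisfy the same formulas with path quantifiers $\exists^{pos},\forall^{pos}$; by $\approx^{pos,\bigcirc}$ if they satisfy the same such formulas whose only temporal operator is $\bigcirc$; and by $\simeq$ (ATL equivalence) if they satisfy the same formulas with path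 quantifiers $\langle\!\langle 1\rangle\!\rangle,\langle\!\langle p\rangle\!\rangle,\langle\!\langle 1,p\rangle\!\rangle,\langle\!\langle\emptyset\rangle\!\rangle$. **Theorem.** 1. On every finitely-branching MDP, $\approx^{pos,\bigcirc}\;=\;\simeq$. 2. On every MDP, $\approx^{pos}\;\subseteq\;\approx^{pos,\bigcirc}$. 3. On every finite AMDP, $\approx^{pos,\bigcirc}\;=\;\approx^{pos}$. 4. There is an infinite, finitely-branching AMDP on which $\approx^{pos,\bigcirc}\;\not\subseteq\;\approx^{pos}$. 5. There is a finite MDP that is not alternating on which $\approx^{pos,\bigcirc}\;\not\subseteq\;\approx^{pos}$. -/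

import Mathlib

open MeasureTheory ProbabilityTheory
open scoped ENNReal

noncomputable section

/-- A Markov decision process with state space `S` and set of actions `A`, labelled by atomic
propositions from `AP`. Countability of `S` and finiteness of `A` are imposed by the instances
`[Countable S]` and `[Finite A]` wherever an MDP is quantified over. -/
structure MDP (AP S A : Type*) where
  /-- the actions that can be chosen at a state -/
  mov : S → Set A
  mov_nonempty : ∀ s, (mov s).Nonempty
  /-- the next-state probability distribution -/
  trans : S → A → PMF S
  /-- the atomic propositions true at a state -/
  label : S → Set AP

namespace MDP

variable {AP S A : Type*}

/-- The possible destinations of action `a` at state `s`. -/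
def dest (G : MDP AP S A) (s : S) (a : A) : Set S := (G.trans s a).support

/-- Each action available at a state has finitely many possible destinations. -/
def FinitelyBranching (G : MDP AP S A) : Prop :=
  ∀ s, ∀ a ∈ G.mov s, (G.dest s a).Finite

/-- `G` is a (visibly) alternating MDP: the states partition into the nondeterministic states
`S₁`, which are labelled with `turn` and all of whose actions have a unique destination, and the
probabilistic states `Sₚ`, which are not labelled with `turn` and have a unique action. -/
def IsAlternating (turn : AP) (G : MDP AP S A) : Prop :=
  ∃ S₁ Sₚ : Set S, S₁ ∪ Sₚ = Set.univ ∧ Disjoint S₁ Sₚ ∧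
    (∀ s ∈ S₁, turn ∈ G.label s ∧ ∀ a ∈ G.mov s, ∃ t, G.dest s a = {t}) ∧
    (∀ s ∈ Sₚ, turn ∉ G.label s ∧ ∃ a, G.mov s = {a})

end MDP

/-- A history `s₀, …, sₙ` of `n + 1` states. All nonempty finite sequences of states are of this
form for a unique `n`. -/
abbrev History (S : Type*) (n : ℕ) := Finset.Iic n → S

/-- The last state of a history. -/
def History.last {S : Type*} {n : ℕ} (h : History S n) : S := h ⟨n, Finset.mem_Iic.2 le_rfl⟩

/-- The history consisting of the first `n + 1` states of a play. -/
def playPrefix {S : Type*} (w : ℕ → S) (n : ℕ) : History S n := fun i => w i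

namespace MDP

variable {AP S A : Type*}

/-- Player-1 strategies (history-dependent and randomized). -/
structure Strategy₁ (G : MDP AP S A) where
  act : (n : ℕ) → History S n → PMF A
  support_subset : ∀ n (h : History S n), (act n h).support ⊆ G.mov h.last

/-- Player-`p` strategies (history-dependent and randomized); the player sees the history and the
action just chosen by player 1. -/
structure Strategyₚ (G : MDP AP S A) where
  move : (n : ℕ) → History S n → A → PMF S
  support_subset : ∀ n (h : History S n), ∀ a ∈ G.mov h.last,
    (move n h a).support ⊆ G.dest h.last a

/-- The player-`p` strategy that follows the transition probabilities of the MDP. -/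
def natural (G : MDP AP S A) : G.Strategyₚ where
  move _ h a := G.trans h.last a
  support_subset _ _ _ _ := subset_rfl

/-- The set of feasible plays from `s` under the strategies `σ` and `τ`. -/
def outcome (G : MDP AP S A) (s : S) (σ : G.Strategy₁) (τ : G.Strategyₚ) : Set (ℕ → S) :=
  {w | w 0 = s ∧ ∀ k, ∃ a ∈ G.mov (w k),
    0 < σ.act k (playPrefix w k) a ∧ 0 < τ.move k (playPrefix w k) a (w (k + 1))}

/-- The distribution of the next state after history `h` under the strategies `σ` and `τ`. -/
def nextState (G : MDP AP S A) (σ : G.Strategy₁) (τ : G.Strategyₚ) (n : ℕ) (h : History S n) :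
    PMF S :=
  (σ.act n h).bind (τ.move n h)

/-- The Markov kernel from histories to next states; the countable set `S` carries the discrete
σ-algebra. -/
def stepKernel [Countable S] (G : MDP AP S A) (σ : G.Strategy₁) (τ : G.Strategyₚ) (n : ℕ) :
    letI : MeasurableSpace S := ⊤
    Kernel (History S n) S :=
  letI : MeasurableSpace S := ⊤
  Kernel.ofFunOfCountable fun h => (G.nextState σ τ n h).toMeasure

theorem isMarkovKernel_stepKernel [Countable S] (G : MDP AP S A) (σ : G.Strategy₁)
    (τ : G.Strategyₚ) (n : ℕ) :
    letI : MeasurableSpace S := ⊤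
    IsMarkovKernel (G.stepKernel σ τ n) := by
  let _ : MeasurableSpace S := ⊤
  exact ⟨fun h => PMF.toMeasure.isProbabilityMeasure (G.nextState σ τ n h)⟩

/-- The law of the play that starts at `s` and follows the strategies `σ` and `τ`, obtained from
the one-step kernels by the Ionescu-Tulcea theorem; a measure on the product σ-algebra. -/
def playMeasure [Countable S] (G : MDP AP S A) (s : S) (σ : G.Strategy₁) (τ : G.Strategyₚ) :
    letI : MeasurableSpace S := ⊤
    Measure (ℕ → S) :=
  letI : MeasurableSpace S := ⊤
  haveI := G.isMarkovKernel_stepKernel σ τ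
  Kernel.traj (X := fun _ => S) (fun n => G.stepKernel σ τ n) 0 (fun _ => s)

/-- The probability of the event `E` from `s` under `σ` when the next state is chosen according to
the transition probabilities. -/
def prob [Countable S] (G : MDP AP S A) (s : S) (σ : G.Strategy₁) (E : Set (ℕ → S)) : ℝ≥0∞ :=
  letI : MeasurableSpace S := ⊤
  G.playMeasure s σ G.natural E

end MDP

/-- State formulas in which every temporal operator is immediately preceded by a path quantifier,
with path quantifiers taken from `Q`. -/
inductive Formula (AP Q : Type*) where
  | tru : Formula AP Q
  | atom (q : AP) : Formula AP Q
  | neg (f : Formula AP Q) : Formula AP Q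
  | or (f g : Formula AP Q) : Formula AP Q
  /-- path quantifier applied to a state formula -/
  | qState (Z : Q) (f : Formula AP Q) : Formula AP Q
  /-- path quantifier applied to "next `f`" -/
  | qNext (Z : Q) (f : Formula AP Q) : Formula AP Q
  /-- path quantifier applied to "`f` until `g`" -/
  | qUntil (Z : Q) (f g : Formula AP Q) : Formula AP Q
  /-- path quantifier applied to "`f` wait-for `g`" -/
  | qWait (Z : Q) (f g : Formula AP Q) : Formula AP Q

/-- The next operator is the only temporal operator of the formula. -/
def Formula.NextOnly {AP Q : Type*} : Formula AP Q → Prop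
  | .tru => True
  | .atom _ => True
  | .neg f => f.NextOnly
  | .or f g => f.NextOnly ∧ g.NextOnly
  | .qState _ f => f.NextOnly
  | .qNext _ f => f.NextOnly
  | .qUntil _ _ _ => False
  | .qWait _ _ _ => False

/-- Plays whose first state is in `X`. -/
def stateEvent {S : Type*} (X : Set S) : Set (ℕ → S) := {w | w 0 ∈ X}

/-- Plays satisfying "next `X`". -/
def nextEvent {S : Type*} (X : Set S) : Set (ℕ → S) := {w | w 1 ∈ X}

/-- Plays satisfying "`X` until `Y`". -/
def untilEvent {S : Type*} (X Y : Set S) : Set (ℕ → S) :=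
  {w | ∃ j, w j ∈ Y ∧ ∀ i < j, w i ∈ X}

/-- Plays satisfying "`X` wait-for `Y`". -/
def waitEvent {S : Type*} (X Y : Set S) : Set (ℕ → S) :=
  {w | (∀ j, w j ∈ X) ∨ ∃ j, w j ∈ Y ∧ ∀ i ≤ j, w i ∈ X}

/-- The path quantifiers `∃^pos` and `∀^pos`. -/
inductive PosQuantifier where
  | existsPos
  | forallPos

/-- The path quantifiers `⟪1⟫`, `⟪p⟫`, `⟪1,p⟫` and `⟪∅⟫` of ATL. -/
inductive ATLQuantifier where
  | one
  | p
  | both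
  | none

namespace MDP

variable {AP S A : Type*}

/-- Semantics of state formulas over `G`, as the set of states satisfying the formula, given the
interpretation `I` of the path quantifiers. -/
def sem {Q : Type*} (G : MDP AP S A) (I : Q → S → Set (ℕ → S) → Prop) :
    Formula AP Q → Set S
  | .tru => Set.univ
  | .atom q => {s | q ∈ G.label s}
  | .neg f => (G.sem I f)ᶜ
  | .or f g => G.sem I f ∪ G.sem I g
  | .qState Z f => {s | I Z s (stateEvent (G.sem I f))}
  | .qNext Z f => {s | I Z s (nextEvent (G.sem I f))}
  | .qUntil Z f g => {s | I Z s (untilEvent (G.sem I f) (G.sem I g))}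
  | .qWait Z f g => {s | I Z s (waitEvent (G.sem I f) (G.sem I g))}

/-- Meaning of `∃^pos` and `∀^pos` in the 1½-player interpretation. -/
def posInterp [Countable S] (G : MDP AP S A) : PosQuantifier → S → Set (ℕ → S) → Prop
  | .existsPos, s, E => ∃ σ : G.Strategy₁, 0 < G.prob s σ E
  | .forallPos, s, E => ∀ σ : G.Strategy₁, 0 < G.prob s σ E

/-- Meaning of the ATL path quantifiers in the 2-player interpretation. -/
def atlInterp (G : MDP AP S A) : ATLQuantifier → S → Set (ℕ → S) → Prop
  | .one, s, E => ∃ σ : G.Strategy₁, ∀ τ : G.Strategyₚ, G.outcome s σ τ ⊆ E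
  | .p, s, E => ∃ τ : G.Strategyₚ, ∀ σ : G.Strategy₁, G.outcome s σ τ ⊆ E
  | .both, s, E => ∃ σ : G.Strategy₁, ∃ τ : G.Strategyₚ, G.outcome s σ τ ⊆ E
  | .none, s, E => ∀ σ : G.Strategy₁, ∀ τ : G.Strategyₚ, G.outcome s σ τ ⊆ E

/-- `≈^pos`: the two states satisfy the same formulas of QRCTL with path quantifiers `∃^pos`,
`∀^pos`. -/
def posEquiv [Countable S] (G : MDP AP S A) : Set (S × S) :=
  {x | ∀ f : Formula AP PosQuantifier,
    x.1 ∈ G.sem G.posInterp f ↔ x.2 ∈ G.sem G.posInterp f}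

/-- `≈^{pos,○}`: as `≈^pos`, for the formulas whose only temporal operator is next. -/
def posNextEquiv [Countable S] (G : MDP AP S A) : Set (S × S) :=
  {x | ∀ f : Formula AP PosQuantifier, f.NextOnly →
    (x.1 ∈ G.sem G.posInterp f ↔ x.2 ∈ G.sem G.posInterp f)}

/-- The ATL equivalence: the two states satisfy the same formulas of ATL. -/
def atlEquiv (G : MDP AP S A) : Set (S × S) :=
  {x | ∀ f : Formula AP ATLQuantifier,
    x.1 ∈ G.sem G.atlInterp f ↔ x.2 ∈ G.sem G.atlInterp f}

end MDP

end

/-! The proof runs on the one-step predecessors `pre C X`, the states where coalition `C` can force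
the next state into `X`. Whether "next" has positive probability depends only on supports of
transitions, so `∃^pos ○` and `∀^pos ○` are `pre .both` and `pre .p`, and complements supply `pre
.none` and `pre .one`.

Equality with ATL equivalence. Under finite branching and finitely many actions, finitely many
states can be separated at once by a next-formula, so every `pre C` preserves unions of
`≈^{pos,○}`-classes (`FinitelyBranching.saturated_pre`). Finite branching also makes `pre C`
continuous, so ATL until is the union of the finite iterates of a one-step operator, and wait-for is
its dual. Hence ATL formulas define unions of classes. Conversely, next-formulas translate into ATL.

Finite AMDPs. Until with positive probability is the same fixed point as in ATL. Wait-for involves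
genuine limits of probabilities, but in a finite MDP the positive transition probabilities are
bounded below, so ranks of fixed points become exponential potentials that bound the probability
(`prob_waitEvent_pos_of_rank`, `prob_waitEvent_eq_zero_of_rank`). For `∃^pos` the resulting set is
again built from `pre`. For `∀^pos` the complement is an almost-sure reachability set, a nested
fixed point over `almostPre Z W`, in which one and the same action must surely stay in `Z` and
possibly enter `W`. Alternation is what lets this be expressed by `pre`
(`IsAlternating.almostPre_eq`).

Counterexamples. Without finiteness, two chains with equal supports may differ in whether they are
absorbed almost surely (`race`). Without alternation, an action combining safety and progress is
invisible to next-formulas if other actions offer the two separately (`gamble`). -/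

noncomputable section

/-! ### Histories and prefixes of plays -/

namespace History

variable {S : Type*} {n : ℕ}

/-- The history `h` followed by the state `u`. -/
def snoc (h : History S n) (u : S) : History S (n + 1) :=
  fun i => if hi : (i : ℕ) ≤ n then h ⟨i, Finset.mem_Iic.2 hi⟩ else u

/-- The state of a history at time `i`. -/
def get (h : History S n) (i : ℕ) (hi : i ≤ n) : S := h ⟨i, Finset.mem_Iic.2 hi⟩

@[simp] theorem last_snoc (h : History S n) (u : S) : (h.snoc u).last = u := by
  simp [last, snoc]

@[simp] theorem get_snoc_of_le (h : History S n) (u : S) {i : ℕ} (hi : i ≤ n) :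
    (h.snoc u).get i (hi.trans n.le_succ) = h.get i hi := by
  simp [get, snoc, hi]

@[simp] theorem get_snoc_succ (h : History S n) (u : S) :
    (h.snoc u).get (n + 1) le_rfl = u := by
  simp [get, snoc]

theorem snoc_inj {h h' : History S n} {u u' : S} : h.snoc u = h'.snoc u' ↔ h = h' ∧ u = u' := by
  refine ⟨fun e => ⟨?_, by simpa using congrArg last e⟩, by rintro ⟨rfl, rfl⟩; rfl⟩
  funext ⟨i, hi⟩
  have hi' := Finset.mem_Iic.1 hi
  have e' := congrArg (fun x : History S (n + 1) => x.get i (hi'.trans n.le_succ)) e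
  simp only [get_snoc_of_le _ _ hi'] at e'
  exact e'

theorem get_self (h : History S n) : h.get n le_rfl = h.last := rfl

end History

section playPrefix

variable {S : Type*} (w : ℕ → S) (n : ℕ)

@[simp] theorem last_playPrefix : (playPrefix w n).last = w n := rfl

theorem playPrefix_succ : playPrefix w (n + 1) = (playPrefix w n).snoc (w (n + 1)) := by
  funext ⟨i, hi⟩
  rcases (Finset.mem_Iic.1 hi).lt_or_eq with h | rfl
  · simp [playPrefix, History.snoc, Nat.lt_succ_iff.1 h]
  · simp [playPrefix, History.snoc]

end playPrefix

/-! ### Expectations along a play and probability estimates -/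

theorem PMF.tsum_bind_mul {α β : Type*} (p : PMF α) (f : α → PMF β) (v : β → ℝ≥0∞) :
    ∑' u, p.bind f u * v u = ∑' a, p a * ∑' u, f a u * v u := by
  simp_rw [PMF.bind_apply, ← ENNReal.tsum_mul_right, ← ENNReal.tsum_mul_left, mul_assoc]
  exact ENNReal.tsum_comm

theorem PMF.tsum_mul_le {α : Type*} (p : PMF α) {f : α → ℝ≥0∞} {c : ℝ≥0∞}
    (h : ∀ a ∈ p.support, f a ≤ c) : ∑' a, p a * f a ≤ c := by
  calc ∑' a, p a * f a ≤ ∑' a, p a * c := by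
        refine ENNReal.tsum_le_tsum fun a => ?_
        by_cases ha : p a = 0
        · simp [ha]
        · exact mul_le_mul_right (h a ha) _
    _ = c := by rw [ENNReal.tsum_mul_right, p.tsum_coe, one_mul]

theorem PMF.le_tsum_mul {α : Type*} (p : PMF α) {f : α → ℝ≥0∞} {c : ℝ≥0∞}
    (h : ∀ a ∈ p.support, c ≤ f a) : c ≤ ∑' a, p a * f a := by
  calc c = ∑' a, p a * c := by rw [ENNReal.tsum_mul_right, p.tsum_coe, one_mul]
    _ ≤ ∑' a, p a * f a := by
        refine ENNReal.tsum_le_tsum fun a => ?_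
        by_cases ha : p a = 0
        · simp [ha]
        · exact mul_le_mul_right (h a ha) _

namespace MDP

variable {AP S A : Type*} [Countable S] (G : MDP AP S A) (s : S) (σ : G.Strategy₁)

/-- The expectation of a function of the first `n + 1` states of the play that starts at `s` and
follows `σ`. -/
def expect (n : ℕ) (F : History S n → ℝ≥0∞) : ℝ≥0∞ :=
  letI : MeasurableSpace S := ⊤
  ∫⁻ w, F (playPrefix w n) ∂(G.playMeasure s σ G.natural)

theorem prob_univ : G.prob s σ Set.univ = 1 := by
  let _ : MeasurableSpace S := ⊤
  have := G.isMarkovKernel_stepKernel σ G.natural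
  simp only [prob, playMeasure]
  exact measure_univ

theorem prob_mono {E E' : Set (ℕ → S)} (h : E ⊆ E') : G.prob s σ E ≤ G.prob s σ E' := by
  let _ : MeasurableSpace S := ⊤
  exact measure_mono h

theorem prob_union_le (E E' : Set (ℕ → S)) :
    G.prob s σ (E ∪ E') ≤ G.prob s σ E + G.prob s σ E' := by
  let _ : MeasurableSpace S := ⊤
  exact measure_union_le E E'

theorem prob_iUnion_null {E : ℕ → Set (ℕ → S)} (h : ∀ n, G.prob s σ (E n) = 0) :
    G.prob s σ (⋃ n, E n) = 0 := by
  let _ : MeasurableSpace S := ⊤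
  exact measure_iUnion_null h

theorem prob_iUnion_le {E : ℕ → Set (ℕ → S)} (hE : Monotone E) {c : ℝ≥0∞}
    (h : ∀ n, G.prob s σ (E n) ≤ c) : G.prob s σ (⋃ n, E n) ≤ c := by
  let _ : MeasurableSpace S := ⊤
  have := hE.measure_iUnion (μ := G.playMeasure s σ G.natural)
  simp only [prob] at h ⊢
  rw [this]
  exact iSup_le h

theorem expect_zero (F : History S 0 → ℝ≥0∞) : G.expect s σ 0 F = F (fun _ => s) := by
  let _ : MeasurableSpace S := ⊤
  have := G.isMarkovKernel_stepKernel σ G.natural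
  have key := Kernel.traj_map_frestrictLe_apply (X := fun _ => S)
    (κ := fun n => G.stepKernel σ G.natural n) 0 0 (fun _ => s)
  have hF : Measurable F := .of_discrete
  have hp : Measurable (Preorder.frestrictLe (π := fun _ => S) 0) := by fun_prop
  simp only [expect, playMeasure]
  change ∫⁻ w, F (Preorder.frestrictLe (π := fun _ => S) 0 w) ∂_ = _
  rw [← lintegral_map hF hp, key, Kernel.partialTraj_self, Kernel.id_apply, lintegral_dirac]

/-- The Ionescu-Tulcea law of a longer prefix is the law of the shorter one composed with one kernel
step. The later probability computations rest on this recursion and on `expect_zero`. -/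
theorem expect_succ (n : ℕ) (F : History S (n + 1) → ℝ≥0∞) :
    G.expect s σ (n + 1) F =
      G.expect s σ n fun h => ∑' u, G.nextState σ G.natural n h u * F (h.snoc u) := by
  let _ : MeasurableSpace S := ⊤
  have := G.isMarkovKernel_stepKernel σ G.natural
  have key := Kernel.partialTraj_compProd_eq_map_traj (X := fun _ => S)
    (κ := fun n => G.stepKernel σ G.natural n) (Nat.zero_le n) (x₀ := fun _ => s)
  rw [← Kernel.traj_map_frestrictLe_apply] at key
  have hp : Measurable (Preorder.frestrictLe (π := fun _ => S) n) := by fun_prop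
  have hF : Measurable (fun x : History S n × S => F (x.1.snoc x.2)) := .of_discrete
  simp only [expect, playMeasure, playPrefix_succ]
  change ∫⁻ w, (fun x : History S n × S => F (x.1.snoc x.2))
    ((fun x : ℕ → S => (Preorder.frestrictLe (π := fun _ => S) n x, x (n + 1))) w) ∂_ = _
  rw [← lintegral_map hF (by fun_prop), ← key, Measure.lintegral_compProd hF,
    lintegral_map .of_discrete hp]
  refine lintegral_congr fun w => ?_
  rw [lintegral_countable']
  refine tsum_congr fun u => ?_
  rw [mul_comm]
  congr 1
  exact PMF.toMeasure_apply_singleton _ _ trivial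

theorem prob_playPrefix_mem (n : ℕ) (B : Set (History S n)) :
    G.prob s σ {w | playPrefix w n ∈ B} = G.expect s σ n (B.indicator 1) := by
  let _ : MeasurableSpace S := ⊤
  have hp : Measurable (fun w : ℕ → S => playPrefix w n) := by
    change Measurable (Preorder.frestrictLe (π := fun _ => S) n)
    fun_prop
  simp only [prob, expect]
  exact (lintegral_indicator_one (hp (show MeasurableSet B from .of_discrete))).symm

theorem expect_mono {n : ℕ} {F F' : History S n → ℝ≥0∞} (h : ∀ x, F x ≤ F' x) :
    G.expect s σ n F ≤ G.expect s σ n F' := by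
  let _ : MeasurableSpace S := ⊤
  exact lintegral_mono fun w => h _

theorem expect_const_mul {n : ℕ} (c : ℝ≥0∞) (F : History S n → ℝ≥0∞) :
    G.expect s σ n (fun h => c * F h) = c * G.expect s σ n F := by
  let _ : MeasurableSpace S := ⊤
  have hp : Measurable (fun w : ℕ → S => playPrefix w n) := by
    change Measurable (Preorder.frestrictLe (π := fun _ => S) n)
    fun_prop
  exact lintegral_const_mul c ((Measurable.of_discrete (f := F)).comp hp)

/-- Markov's inequality. -/
theorem mul_prob_le_expect {n : ℕ} {F : History S n → ℝ≥0∞} {E : Set (ℕ → S)} {m : ℝ≥0∞}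
    (h : ∀ w ∈ E, m ≤ F (playPrefix w n)) : m * G.prob s σ E ≤ G.expect s σ n F := by
  calc m * G.prob s σ E ≤ m * G.prob s σ {w | playPrefix w n ∈ {x | m ≤ F x}} :=
        mul_le_mul_right (G.prob_mono s σ h) _
    _ = G.expect s σ n (fun x => m * Set.indicator {x | m ≤ F x} 1 x) := by
        rw [prob_playPrefix_mem, expect_const_mul]
    _ ≤ G.expect s σ n F := by
        refine G.expect_mono s σ fun x => ?_
        by_cases hx : m ≤ F x <;> simp [Set.indicator, hx]

/-- A potential that shrinks by the factor `c` in each step. -/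
theorem expect_le_pow_mul {c : ℝ≥0∞} {V : ∀ n, History S n → ℝ≥0∞}
    (hV : ∀ n (h : History S n), ∀ a ∈ (σ.act n h).support,
      ∑' u, G.trans h.last a u * V (n + 1) (h.snoc u) ≤ c * V n h) (n : ℕ) :
    G.expect s σ n (V n) ≤ c ^ n * V 0 (fun _ => s) := by
  induction n with
  | zero => simp [expect_zero]
  | succ n ih =>
    rw [expect_succ, pow_succ', mul_assoc]
    refine le_trans ?_ (mul_le_mul_right ih c)
    rw [← expect_const_mul]
    refine G.expect_mono s σ fun h => ?_
    rw [nextState, PMF.tsum_bind_mul]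
    exact PMF.tsum_mul_le _ (hV n h)

theorem prob_prefix_zero : G.prob s σ {w | playPrefix w 0 = fun _ => s} = 1 := by
  have := G.prob_playPrefix_mem s σ 0 {fun _ => s}
  rw [expect_zero] at this
  simpa using this

theorem prob_prefix_snoc {n : ℕ} (h : History S n) (u : S) :
    G.prob s σ {w | playPrefix w (n + 1) = h.snoc u} =
      G.nextState σ G.natural n h u * G.prob s σ {w | playPrefix w n = h} := by
  have h1 := G.prob_playPrefix_mem s σ (n + 1) {h.snoc u}
  have h2 := G.prob_playPrefix_mem s σ n {h}
  simp only [Set.mem_singleton_iff] at h1 h2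
  rw [h1, h2, expect_succ, ← expect_const_mul]
  congr 1
  funext h'
  by_cases hh : h' = h
  · subst hh
    rw [tsum_eq_single u]
    · simp
    · intro v hv
      simp [History.snoc_inj, hv]
  · simp [History.snoc_inj, hh]

/-- Almost every play is an outcome. -/
theorem prob_compl_outcome : G.prob s σ (G.outcome s σ G.natural)ᶜ = 0 := by
  have hsub : (G.outcome s σ G.natural)ᶜ ⊆ {w | w 0 ≠ s} ∪ ⋃ k, {w | ¬ ∃ a ∈ G.mov (w k),
      0 < σ.act k (playPrefix w k) a ∧ 0 < G.natural.move k (playPrefix w k) a (w (k + 1))} := by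
    intro w hw
    by_contra hc
    rw [Set.mem_union, Set.mem_iUnion, not_or, not_exists] at hc
    exact hw ⟨not_not.1 hc.1, fun k => not_not.1 (hc.2 k)⟩
  refine le_antisymm (((G.prob_mono s σ hsub).trans (G.prob_union_le s σ _ _)).trans ?_) zero_le
  have h0 : G.prob s σ {w | w 0 ≠ s} = 0 := by
    have := G.prob_playPrefix_mem s σ 0 {h | h.last ≠ s}
    rw [expect_zero, Set.indicator_of_notMem (by simp [History.last])] at this
    exact this
  rw [h0, zero_add]
  refine (G.prob_iUnion_null s σ fun k => ?_).le
  -- A play that breaks the rules at time `k` makes a transition to which `nextState` gives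
  -- probability `0`.
  have := G.prob_playPrefix_mem s σ (k + 1) {h | ∃ h' : History S k, ∃ u, h = h'.snoc u ∧
    G.nextState σ G.natural k h' u = 0}
  rw [expect_succ] at this
  have hz : ∀ (h : History S k) (u : S), G.nextState σ G.natural k h u *
      Set.indicator {h | ∃ h' : History S k, ∃ u, h = h'.snoc u ∧
        G.nextState σ G.natural k h' u = 0} 1 (h.snoc u) = 0 := by
    intro h u
    by_cases hu : h.snoc u ∈ {h | ∃ h' : History S k, ∃ u, h = h'.snoc u ∧
        G.nextState σ G.natural k h' u = 0}
    · obtain ⟨h', u', e, hz⟩ := hu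
      obtain ⟨rfl, rfl⟩ := History.snoc_inj.1 e
      simp [hz]
    · rw [Set.indicator_of_notMem hu, mul_zero]
  simp only [hz, tsum_zero] at this
  have hzero : G.expect s σ k (fun _ => 0) = 0 := by
    have := G.expect_const_mul s σ (n := k) 0 (fun _ => 0)
    simpa using this
  rw [hzero] at this
  refine le_antisymm ((G.prob_mono s σ ?_).trans this.le) zero_le
  intro w hw
  refine ⟨playPrefix w k, w (k + 1), playPrefix_succ w k, ?_⟩
  by_contra hne
  rw [← ne_eq, ← PMF.mem_support_iff, nextState, PMF.mem_support_bind_iff] at hne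
  obtain ⟨a, ha, hu⟩ := hne
  exact hw ⟨a, σ.support_subset k _ ha, (PMF.apply_pos_iff _ _).2 ha, (PMF.apply_pos_iff _ _).2 hu⟩

/-- The bridge from probabilities to the two-player game: an event that misses all outcomes is null.
-/
theorem exists_mem_outcome_of_prob_pos {E : Set (ℕ → S)} (h : 0 < G.prob s σ E) :
    ∃ w ∈ E, w ∈ G.outcome s σ G.natural := by
  by_contra! hc
  exact h.ne' (le_antisymm ((G.prob_mono s σ hc).trans (G.prob_compl_outcome s σ).le) zero_le)

theorem prob_nextEvent_pos_iff (X : Set S) :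
    0 < G.prob s σ (nextEvent X) ↔
      ∃ a ∈ (σ.act 0 fun _ => s).support, ∃ u ∈ G.dest s a, u ∈ X := by
  have h := G.prob_playPrefix_mem s σ 1 {h | h.last ∈ X}
  rw [expect_succ, expect_zero] at h
  have h' : G.prob s σ (nextEvent X) = _ := h
  rw [h', pos_iff_ne_zero, ne_eq, ENNReal.tsum_eq_zero, not_forall]
  simp only [mul_eq_zero, not_or, nextState, ← ne_eq, ← PMF.mem_support_iff,
    PMF.mem_support_bind_iff, Set.indicator_apply_ne_zero]
  constructor
  · rintro ⟨u, ⟨a, ha, hu⟩, hX, -⟩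
    exact ⟨a, ha, u, hu, by simpa using hX⟩
  · rintro ⟨a, ha, u, hu, hX⟩
    exact ⟨u, ⟨a, ha, hu⟩, by simpa using hX, by simp⟩

theorem prob_stateEvent_pos_iff (X : Set S) : 0 < G.prob s σ (stateEvent X) ↔ s ∈ X := by
  have h := G.prob_playPrefix_mem s σ 0 {h | h.last ∈ X}
  rw [expect_zero] at h
  have h' : G.prob s σ (stateEvent X) = _ := h
  rw [h', pos_iff_ne_zero, ne_eq, Set.indicator_apply_eq_zero]
  simp [History.last]

/-- A criterion for "`X` wait-for `Y`" to be a null event. -/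
theorem prob_waitEvent_eq_zero {X Y : Set S} {c m : ℝ≥0∞} {v : S → ℝ≥0∞} (hc : c < 1)
    (hm : m ≠ 0) (hvm : ∀ u ∈ X, m ≤ v u) (hvY : ∀ u ∈ X, u ∈ Y → v u = ∞) (hs : v s ≠ ∞)
    (hv : ∀ n (h : History S n), h.last ∈ X → ∀ a ∈ (σ.act n h).support,
      ∑' u, G.trans h.last a u * v u ≤ c * v h.last) :
    G.prob s σ (waitEvent X Y) = 0 := by
  classical
  -- The potential `v`, killed once `X` has been left; its expectation is at most `c ^ n * v s`.
  -- Staying in `X` forever keeps it above `m`, against convergence to `0`; meeting `Y` inside `X`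
  -- makes it infinite, against finiteness.
  let V : ∀ n, History S n → ℝ≥0∞ := fun n h =>
    if ∀ i, ∀ hi : i < n, h.get i hi.le ∈ X then v h.last else 0
  have hle := G.expect_le_pow_mul s σ (c := c) (V := V) (by
    intro n h a ha
    by_cases hX : ∀ i, ∀ hi : i < n, h.get i hi.le ∈ X
    · by_cases hl : h.last ∈ X
      · simp only [V, if_pos hX]
        refine le_trans (ENNReal.tsum_le_tsum fun u => mul_le_mul_right ?_ _) (hv n h hl a ha)
        split_ifs <;> simp
      · have : ∀ u, V (n + 1) (h.snoc u) = 0 := fun u => if_neg fun hc => hl (by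
          simpa [History.get_self] using hc n n.lt_succ_self)
        simp [this]
    · have : ∀ u, V (n + 1) (h.snoc u) = 0 := fun u => if_neg fun hc => hX fun i hi => by
        simpa [hi.le] using hc i (hi.trans n.lt_succ_self)
      simp [this])
  have hV0 : V 0 (fun _ => s) = v s := by simp [V, History.last]
  rw [hV0] at hle
  have hfin : ∀ n, c ^ n * v s ≠ ∞ := fun n =>
    ENNReal.mul_ne_top (ENNReal.pow_ne_top (hc.trans ENNReal.one_lt_top).ne) hs
  have hsub : waitEvent X Y ⊆ {w | ∀ j, w j ∈ X} ∪
      ⋃ n, {w : ℕ → S | w n ∈ Y ∧ ∀ i ≤ n, w i ∈ X} := by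
    rintro w (hw | ⟨j, hj⟩)
    · exact .inl hw
    · exact .inr (Set.mem_iUnion.2 ⟨j, hj⟩)
  refine le_antisymm (((G.prob_mono s σ hsub).trans (G.prob_union_le s σ _ _)).trans ?_) zero_le
  have h1 : G.prob s σ {w | ∀ j, w j ∈ X} = 0 := by
    have hb : ∀ n, m * G.prob s σ {w | ∀ j, w j ∈ X} ≤ c ^ n * v s := fun n =>
      (G.mul_prob_le_expect s σ fun w hw => by
        have : ∀ i, ∀ hi : i < n, (playPrefix w n).get i hi.le ∈ X := fun i hi => hw i
        simp only [V, if_pos this]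
        exact hvm _ (hw n)).trans (hle n)
    have hlim : Filter.Tendsto (fun n => c ^ n * v s) Filter.atTop (nhds 0) := by
      simpa using ENNReal.Tendsto.mul_const (ENNReal.tendsto_pow_atTop_nhds_zero_of_lt_one hc)
        (.inr hs)
    have := le_antisymm (ge_of_tendsto' hlim hb) zero_le
    exact (mul_eq_zero.1 this).resolve_left hm
  rw [h1, zero_add]
  refine (G.prob_iUnion_null s σ fun n => ?_).le
  have hb : ∞ * G.prob s σ {w : ℕ → S | w n ∈ Y ∧ ∀ i ≤ n, w i ∈ X} ≤ c ^ n * v s :=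
    (G.mul_prob_le_expect s σ fun w hw => by
      have : ∀ i, ∀ hi : i < n, (playPrefix w n).get i hi.le ∈ X := fun i hi => hw.2 i hi.le
      simp only [V, if_pos this]
      exact (hvY _ (hw.2 n le_rfl) hw.1).ge).trans (hle n)
  by_contra hne
  rw [ENNReal.top_mul hne] at hb
  exact hfin n (top_le_iff.1 hb)

/-- The witness is the first exit from `X`: a visit to `Y` before it would already fulfil the
wait-for. -/
theorem compl_waitEvent {S : Type*} (X Y : Set S) :
    (waitEvent X Y)ᶜ = {w | ∃ j, w j ∉ X ∧ ∀ i < j, w i ∈ X ∧ w i ∉ Y} := by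
  classical
  ext w
  constructor
  · intro hw
    have hex : ∃ j, w j ∉ X := by
      by_contra! hc
      exact hw (.inl hc)
    refine ⟨Nat.find hex, Nat.find_spec hex, fun i hi => ?_⟩
    have hX : ∀ k ≤ i, w k ∈ X := fun k hk => not_not.1 (Nat.find_min hex (hk.trans_lt hi))
    exact ⟨hX i le_rfl, fun hY => hw (.inr ⟨i, hY, hX⟩)⟩
  · rintro ⟨j, hj, hlt⟩ (hw | ⟨k, hk, hX⟩)
    · exact hj (hw j)
    · rcases lt_or_ge k j with h | h
      · exact (hlt k h).2 hk
      · exact hj (hX j h)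

/-- A lower bound for the probability of "`X` wait-for `Y`". -/
theorem le_prob_waitEvent {X Y : Set S} {v : S → ℝ≥0∞} (hv1 : ∀ u, v u ≤ 1)
    (hvX : ∀ u ∉ X, v u = 0)
    (hv : ∀ n (h : History S n), h.last ∈ X → h.last ∉ Y → ∀ a ∈ (σ.act n h).support,
      v h.last ≤ ∑' u, G.trans h.last a u * v u) :
    v s ≤ G.prob s σ (waitEvent X Y) := by
  classical
  let C : ∀ n, History S n → Prop := fun n h =>
    ∃ j, ∃ hj : j ≤ n, h.get j hj ∉ X ∧
      ∀ i, ∀ hi : i < j, h.get i (hi.le.trans hj) ∈ X ∧ h.get i (hi.le.trans hj) ∉ Y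
  let B : ∀ n, History S n → Prop := fun n h => ∀ i, ∀ hi : i ≤ n, h.get i hi ∈ X ∧ h.get i hi ∉ Y
  let V : ∀ n, History S n → ℝ≥0∞ := fun n h =>
    if C n h then 1 else if B n h then 1 - v h.last else 0
  have hV1 : ∀ n h, V n h ≤ 1 := by
    intro n h
    simp only [V]
    split_ifs <;> simp
  have hle := G.expect_le_pow_mul s σ (c := 1) (V := V) (by
    intro n h a ha
    rw [one_mul]
    by_cases hC : C n h
    · simp only [V, if_pos hC]
      exact PMF.tsum_mul_le _ fun u _ => hV1 _ _
    by_cases hB : B n h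
    · simp only [V, if_neg hC, if_pos hB]
      have hstep : ∀ u, V (n + 1) (h.snoc u) ≤ 1 - v u := by
        intro u
        by_cases hC' : C (n + 1) (h.snoc u)
        · obtain ⟨j, hj, hjX, -⟩ := hC'
          rcases hj.lt_or_eq with hlt | rfl
          · rw [History.get_snoc_of_le _ _ (Nat.lt_succ_iff.1 hlt)] at hjX
            exact absurd (hB j (Nat.lt_succ_iff.1 hlt)).1 hjX
          · rw [History.get_snoc_succ] at hjX
            rw [hvX u hjX, tsub_zero]
            exact hV1 _ _
        · simp only [V, if_neg hC', History.last_snoc]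
          split_ifs <;> simp
      refine le_trans (ENNReal.tsum_le_tsum fun u => mul_le_mul_right (hstep u) _) ?_
      have hfin : v h.last ≠ ∞ := ((hv1 _).trans_lt ENNReal.one_lt_top).ne
      refine ENNReal.le_sub_of_add_le_right hfin ?_
      have := hv n h (hB n le_rfl).1 (hB n le_rfl).2 a ha
      refine (add_le_add_right this _).trans ?_
      rw [← ENNReal.tsum_add]
      simp_rw [← mul_add, tsub_add_cancel_of_le (hv1 _), mul_one]
      exact (G.trans h.last a).tsum_coe.le
    · have : ∀ u, V (n + 1) (h.snoc u) = 0 := by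
        intro u
        have hC' : ¬ C (n + 1) (h.snoc u) := by
          rintro ⟨j, hj, hjX, hlt⟩
          rcases hj.lt_or_eq with hj' | rfl
          · have hjn := Nat.lt_succ_iff.1 hj'
            refine hC ⟨j, hjn, by simpa [hjn] using hjX, fun i hi => ?_⟩
            simpa [hi.le.trans hjn] using hlt i hi
          · refine hB fun i hi => ?_
            simpa [hi] using hlt i (Nat.lt_succ_iff.2 hi)
        have hB' : ¬ B (n + 1) (h.snoc u) := by
          intro hb
          refine hB fun i hi => ?_
          simpa [hi] using hb i (hi.trans n.le_succ)
        simp only [V, if_neg hC', if_neg hB']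
      simp [this])
  have hV0 : V 0 (fun _ => s) ≤ 1 - v s := by
    by_cases hC : C 0 (fun _ => s)
    · obtain ⟨j, hj, hjX, -⟩ := hC
      have : s ∉ X := hjX
      rw [hvX s this, tsub_zero]
      exact hV1 _ _
    · simp only [V, if_neg hC]
      split_ifs <;> simp [History.last]
  have hcompl : G.prob s σ (waitEvent X Y)ᶜ ≤ 1 - v s := by
    rw [compl_waitEvent]
    have : {w : ℕ → S | ∃ j, w j ∉ X ∧ ∀ i < j, w i ∈ X ∧ w i ∉ Y} ⊆
        ⋃ n, {w | C n (playPrefix w n)} := by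
      rintro w ⟨j, hj, hlt⟩
      exact Set.mem_iUnion.2 ⟨j, j, le_rfl, hj, hlt⟩
    refine (G.prob_mono s σ this).trans (G.prob_iUnion_le s σ ?_ fun n => ?_)
    · rintro n m hnm w ⟨j, hj, h⟩
      exact ⟨j, hj.trans hnm, h⟩
    · have h1 : 1 * G.prob s σ {w | C n (playPrefix w n)} ≤ G.expect s σ n (V n) :=
        G.mul_prob_le_expect s σ fun w hw => by
          have : C n (playPrefix w n) := hw
          simp [V, if_pos this]
      rw [one_mul] at h1
      refine h1.trans ((hle n).trans ?_)
      simpa using hV0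
  have htot : 1 ≤ G.prob s σ (waitEvent X Y) + G.prob s σ (waitEvent X Y)ᶜ := by
    rw [← G.prob_univ s σ, ← Set.union_compl_self (waitEvent X Y)]
    exact G.prob_union_le s σ _ _
  have h2 : 1 ≤ G.prob s σ (waitEvent X Y) + (1 - v s) :=
    htot.trans (add_le_add_right hcompl _)
  have h3 : v s + (1 - v s) ≤ G.prob s σ (waitEvent X Y) + (1 - v s) := by
    rwa [add_tsub_cancel_of_le (hv1 s)]
  exact (ENNReal.add_le_add_iff_right (ne_top_of_le_ne_top ENNReal.one_ne_top tsub_le_self)).1 h3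

/-- Positivity of "`X` until `Y`" from a rank that can always decrease. -/
theorem prob_untilEvent_pos {X Y H : Set S} {r : S → ℕ} (hs : s ∈ H)
    (hH : ∀ n (h : History S n), h.last ∈ H → h.last ∉ Y → h.last ∈ X ∧
      ∃ a ∈ (σ.act n h).support, ∃ u ∈ G.dest h.last a, u ∈ H ∧ r u < r h.last) :
    0 < G.prob s σ (untilEvent X Y) := by
  -- One prefix of positive probability is enough: it is extended by successors of smaller rank
  -- until `Y` is met.
  have key : ∀ k n (h : History S n), r h.last = k → h.last ∈ H →
      (∀ i, ∀ hi : i < n, h.get i hi.le ∈ X) → 0 < G.prob s σ {w | playPrefix w n = h} →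
      0 < G.prob s σ (untilEvent X Y) := by
    intro k
    induction k using Nat.strong_induction_on with
    | _ k ih =>
      intro n h hk hl hX hpos
      by_cases hY : h.last ∈ Y
      · refine hpos.trans_le (G.prob_mono s σ ?_)
        rintro w rfl
        exact ⟨n, hY, hX⟩
      · obtain ⟨hlX, a, ha, u, hu, huH, hlt⟩ := hH n h hl hY
        refine ih (r u) (hk ▸ hlt) (n + 1) (h.snoc u) (by simp) (by simpa) ?_ ?_
        · intro i hi
          rcases (Nat.lt_succ_iff.1 hi).lt_or_eq with h' | rfl
          · simpa [h'.le] using hX i h'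
          · simpa [History.get_self] using hlX
        · rw [prob_prefix_snoc]
          refine ENNReal.mul_pos ?_ hpos.ne'
          rw [← PMF.mem_support_iff, nextState, PMF.mem_support_bind_iff]
          exact ⟨a, ha, hu⟩
  exact key _ 0 (fun _ => s) rfl hs (by simp) (by rw [prob_prefix_zero]; exact one_pos)

end MDP

/-! ### Iteration from the empty set, continuity and ranks -/

section iterSup

variable {S : Type*}

/-- The union of the finite iterates of `F` from the empty set: for continuous `F`, its least fixed
point. -/
def iterSup (F : Set S → Set S) : Set S := ⋃ n, F^[n] ∅

/-- `F` is monotone and commutes with unions of increasing sequences. -/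
structure IncContinuous (F : Set S → Set S) : Prop where
  mono : Monotone F
  sub : ∀ W : ℕ → Set S, Monotone W → F (⋃ n, W n) ⊆ ⋃ n, F (W n)

theorem iterSup_induction {F : Set S → Set S} {P : Set S → Prop} (h0 : P ∅)
    (hF : ∀ Z, P Z → P (F Z)) (hU : ∀ W : ℕ → Set S, (∀ n, P (W n)) → P (⋃ n, W n)) :
    P (iterSup F) := by
  refine hU _ fun n => ?_
  induction n with
  | zero => exact h0
  | succ n ih => rw [Function.iterate_succ_apply']; exact hF _ ih

theorem monotone_iterate_empty {F : Set S → Set S} (hF : Monotone F) :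
    Monotone fun n => F^[n] ∅ := by
  refine monotone_nat_of_le_succ fun n => ?_
  induction n with
  | zero => exact Set.empty_subset _
  | succ n ih =>
    rw [Function.iterate_succ_apply', Function.iterate_succ_apply']
    exact hF ih

theorem iterSup_mono {F F' : Set S → Set S} (hF : Monotone F) (h : ∀ Z, F Z ⊆ F' Z) :
    iterSup F ⊆ iterSup F' := by
  refine Set.iUnion_mono fun n => ?_
  induction n with
  | zero => exact subset_rfl
  | succ n ih =>
    rw [Function.iterate_succ_apply', Function.iterate_succ_apply']
    exact (hF ih).trans (h _)

namespace IncContinuous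

variable {F : Set S → Set S}

theorem apply_iterSup_subset (hF : IncContinuous F) : F (iterSup F) ⊆ iterSup F := by
  refine (hF.sub _ (monotone_iterate_empty hF.mono)).trans (Set.iUnion_subset fun n => ?_)
  rw [← Function.iterate_succ_apply' F]
  exact Set.subset_iUnion (fun n => F^[n] ∅) (n + 1)

/-- The stage at which a point enters the iteration. -/
theorem exists_rank_iff (hF : IncContinuous F) :
    ∃ r : S → ℕ, ∀ n s, (s ∈ iterSup F ∧ r s ≤ n) ↔ s ∈ F {u | u ∈ iterSup F ∧ r u < n} := by
  classical
  -- The shift by one makes `F^[n] ∅` the set of points of rank below `n`. The default `0` is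
  -- harmless, as ranks are only read inside `iterSup F`.
  let r : S → ℕ := fun s => if h : ∃ n, s ∈ F^[n + 1] ∅ then Nat.find h else 0
  have hmono := monotone_iterate_empty hF.mono
  have hr : ∀ n s, (s ∈ iterSup F ∧ r s ≤ n) ↔ s ∈ F^[n + 1] ∅ := by
    intro n s
    constructor
    · rintro ⟨hs, hn⟩
      have h : ∃ n, s ∈ F^[n + 1] ∅ := by
        obtain ⟨m, hm⟩ := Set.mem_iUnion.1 hs
        exact ⟨m, hmono m.le_succ hm⟩
      simp only [r, dif_pos h] at hn
      exact hmono (Nat.succ_le_succ hn) (Nat.find_spec h)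
    · intro hs
      have h : ∃ n, s ∈ F^[n + 1] ∅ := ⟨n, hs⟩
      refine ⟨Set.mem_iUnion.2 ⟨_, hs⟩, ?_⟩
      simp only [r, dif_pos h]
      exact Nat.find_min' h hs
  refine ⟨r, fun n s => (hr n s).trans ?_⟩
  rw [Function.iterate_succ_apply']
  have : F^[n] ∅ = {u | u ∈ iterSup F ∧ r u < n} := by
    cases n with
    | zero => ext; simp
    | succ n =>
      ext u
      rw [← hr n u]
      exact and_congr_right fun _ => Nat.lt_succ_iff.symm
  rw [this]

theorem exists_rank (hF : IncContinuous F) :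
    ∃ r : S → ℕ, ∀ s ∈ iterSup F, s ∈ F {u | u ∈ iterSup F ∧ r u < r s} := by
  obtain ⟨r, hr⟩ := hF.exists_rank_iff
  exact ⟨r, fun s hs => (hr _ s).1 ⟨hs, le_rfl⟩⟩

theorem const (X : Set S) : IncContinuous fun _ => X :=
  ⟨fun _ _ _ => subset_rfl, fun _ _ => Set.subset_iUnion (fun _ : ℕ => X) 0⟩

theorem union {F' : Set S → Set S} (hF : IncContinuous F) (hF' : IncContinuous F') :
    IncContinuous fun Z => F Z ∪ F' Z := by
  refine ⟨fun _ _ h => Set.union_subset_union (hF.mono h) (hF'.mono h), fun W hW => ?_⟩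
  rw [Set.iUnion_union_distrib]
  exact Set.union_subset_union (hF.sub W hW) (hF'.sub W hW)

theorem const_inter (X : Set S) (hF : IncContinuous F) : IncContinuous fun Z => X ∩ F Z := by
  refine ⟨fun _ _ h => Set.inter_subset_inter_right _ (hF.mono h), fun W hW => ?_⟩
  rw [← Set.inter_iUnion]
  exact Set.inter_subset_inter_right _ (hF.sub W hW)

/-- Increasing sequences of subsets of a finite set stabilise. -/
theorem of_finite [Finite S] (hF : Monotone F) : IncContinuous F := by
  refine ⟨hF, fun W hW => ?_⟩
  obtain ⟨n, hn⟩ := WellFoundedGT.monotone_chain_condition ⟨W, hW⟩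
  have : ⋃ k, W k = W n := by
    refine subset_antisymm (Set.iUnion_subset fun k => ?_) (Set.subset_iUnion W n)
    have h1 : W (max n k) = W n := (hn _ (le_max_left n k)).symm
    exact h1 ▸ hW (le_max_right n k)
  rw [this]
  exact Set.subset_iUnion (fun k => F (W k)) n

end IncContinuous

/-- A play along which a rank decreases satisfies "`X` until `Y`". -/
theorem mem_untilEvent_of_rank {X Y L : Set S} {r : S → ℕ} {w : ℕ → S} (h0 : w 0 ∈ L)
    (h : ∀ k, w k ∈ L → w k ∈ Y ∨ (w k ∈ X ∧ w (k + 1) ∈ L ∧ r (w (k + 1)) < r (w k))) :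
    w ∈ untilEvent X Y := by
  have key : ∀ n k, r (w k) = n → w k ∈ L → ∃ j ≥ k, w j ∈ Y ∧ ∀ i, k ≤ i → i < j → w i ∈ X := by
    intro n
    induction n using Nat.strong_induction_on with
    | _ n ih =>
      intro k hk hL
      rcases h k hL with hY | ⟨hX, hL', hlt⟩
      · exact ⟨k, le_rfl, hY, fun i h1 h2 => absurd h1 (not_le.2 h2)⟩
      · obtain ⟨j, hj, hY, hi⟩ := ih _ (hk ▸ hlt) (k + 1) rfl hL'
        refine ⟨j, (Nat.le_succ k).trans hj, hY, fun i h1 h2 => ?_⟩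
        rcases h1.lt_or_eq with h' | rfl
        · exact hi i h' h2
        · exact hX
  obtain ⟨j, -, hY, hX⟩ := key _ 0 rfl h0
  exact ⟨j, hY, fun i hi => hX i (Nat.zero_le i) hi⟩

theorem mem_of_mem_untilEvent {X Y L : Set S} {w : ℕ → S} (hw : w ∈ untilEvent X Y)
    (hY : Y ⊆ L) (hX : ∀ k, w k ∈ X → w (k + 1) ∈ L → w k ∈ L) : w 0 ∈ L := by
  obtain ⟨j, hj, hi⟩ := hw
  have : ∀ j, w j ∈ L → (∀ i < j, w i ∈ X) → w 0 ∈ L := by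
    intro j
    induction j with
    | zero => exact fun h _ => h
    | succ j ih =>
      exact fun h hi => ih (hX j (hi j j.lt_succ_self) h) fun i hij => hi i (hij.trans j.lt_succ_self)
  exact this j (hY hj) hi

end iterSup

/-! ### One-step forcing and the ATL temporal operators -/

namespace ATLQuantifier

/-- The quantifier of the opposing coalition. -/
def dual : ATLQuantifier → ATLQuantifier
  | one => p
  | p => one
  | both => none
  | none => both

@[simp] theorem dual_dual (C : ATLQuantifier) : C.dual.dual = C := by cases C <;> rfl

end ATLQuantifier

namespace MDP

variable {AP S A : Type*} (G : MDP AP S A)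

/-- The states at which the coalition `C` can force the next state to be in `X`. -/
def pre : ATLQuantifier → Set S → Set S
  | .one, X => {s | ∃ a ∈ G.mov s, ∀ u ∈ G.dest s a, u ∈ X}
  | .p, X => {s | ∀ a ∈ G.mov s, ∃ u ∈ G.dest s a, u ∈ X}
  | .both, X => {s | ∃ a ∈ G.mov s, ∃ u ∈ G.dest s a, u ∈ X}
  | .none, X => {s | ∀ a ∈ G.mov s, ∀ u ∈ G.dest s a, u ∈ X}

theorem compl_pre (C : ATLQuantifier) (X : Set S) : (G.pre C X)ᶜ = G.pre C.dual Xᶜ := by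
  cases C <;> ext s <;> simp [pre, ATLQuantifier.dual]

theorem pre_compl (C : ATLQuantifier) (X : Set S) : G.pre C Xᶜ = (G.pre C.dual X)ᶜ := by
  rw [compl_pre, ATLQuantifier.dual_dual]

theorem notMem_pre_iff {C : ATLQuantifier} {X : Set S} {s : S} :
    s ∉ G.pre C X ↔ s ∈ G.pre C.dual Xᶜ := by
  rw [← compl_pre]; rfl

theorem pre_mono (C : ATLQuantifier) : Monotone (G.pre C) := by
  intro X Y h s hs
  cases C
  · exact hs.imp fun a ha => ⟨ha.1, fun u hu => h (ha.2 u hu)⟩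
  · exact fun a ha => (hs a ha).imp fun u hu => ⟨hu.1, h hu.2⟩
  · exact hs.imp fun a ha => ⟨ha.1, ha.2.imp fun u hu => ⟨hu.1, h hu.2⟩⟩
  · exact fun a ha u hu => h (hs a ha u hu)

theorem incContinuous_pre [Finite A] (hG : G.FinitelyBranching) (C : ATLQuantifier) :
    IncContinuous (G.pre C) := by
  refine ⟨G.pre_mono C, fun W hW s hs => ?_⟩
  have hev : ∀ u ∈ ⋃ n, W n, ∀ᶠ n in Filter.atTop, u ∈ W n := by
    intro u hu
    obtain ⟨n, hn⟩ := Set.mem_iUnion.1 hu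
    filter_upwards [Filter.eventually_ge_atTop n] with m hm using hW hm hn
  have hall : ∀ a ∈ G.mov s, (∀ u ∈ G.dest s a, u ∈ ⋃ n, W n) →
      ∀ᶠ n in Filter.atTop, ∀ u ∈ G.dest s a, u ∈ W n := fun a ha h =>
    (Filter.eventually_all_finite (hG s a ha)).2 fun u hu => hev u (h u hu)
  suffices h : ∀ᶠ n in Filter.atTop, s ∈ G.pre C (W n) by
    obtain ⟨n, hn⟩ := h.exists
    exact Set.mem_iUnion.2 ⟨n, hn⟩
  cases C
  · obtain ⟨a, ha, h⟩ := hs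
    exact (hall a ha h).mono fun n hn => ⟨a, ha, hn⟩
  · refine (Filter.eventually_all_finite (Set.toFinite _)).2 fun a ha => ?_
    obtain ⟨u, hu, h⟩ := hs a ha
    exact (hev u h).mono fun n hn => ⟨u, hu, hn⟩
  · obtain ⟨a, ha, u, hu, h⟩ := hs
    exact (hev u h).mono fun n hn => ⟨a, ha, u, hu, hn⟩
  · exact (Filter.eventually_all_finite (Set.toFinite _)).2 fun a ha => hall a ha (hs a ha)

/-- The memoryless deterministic player-1 strategy that plays `f`. -/
def Strategy₁.ofAction (f : S → A) (hf : ∀ s, f s ∈ G.mov s) : G.Strategy₁ where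
  act _ h := PMF.pure (f h.last)
  support_subset n h := by simpa using hf h.last

/-- The memoryless deterministic player-`p` strategy that plays `g`. -/
def Strategyₚ.ofDest (g : S → A → S) (hg : ∀ s a, g s a ∈ G.dest s a) : G.Strategyₚ where
  move _ h a := PMF.pure (g h.last a)
  support_subset n h a _ := by simpa using hg h.last a

theorem exists_action (P : S → A → Prop) :
    ∃ f : S → A, ∀ s, f s ∈ G.mov s ∧ ((∃ a ∈ G.mov s, P s a) → P s (f s)) := by
  have : ∀ s, ∃ a, a ∈ G.mov s ∧ ((∃ a ∈ G.mov s, P s a) → P s a) := by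
    intro s
    by_cases h : ∃ a ∈ G.mov s, P s a
    · obtain ⟨a, ha, hP⟩ := h
      exact ⟨a, ha, fun _ => hP⟩
    · obtain ⟨a, ha⟩ := G.mov_nonempty s
      exact ⟨a, ha, fun h' => absurd h' h⟩
  exact ⟨fun s => (this s).choose, fun s => (this s).choose_spec⟩

theorem exists_destination (P : S → A → S → Prop) :
    ∃ g : S → A → S, ∀ s a, g s a ∈ G.dest s a ∧ ((∃ u ∈ G.dest s a, P s a u) → P s a (g s a)) := by
  have : ∀ s a, ∃ u, u ∈ G.dest s a ∧ ((∃ u ∈ G.dest s a, P s a u) → P s a u) := by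
    intro s a
    by_cases h : ∃ u ∈ G.dest s a, P s a u
    · obtain ⟨u, hu, hP⟩ := h
      exact ⟨u, hu, fun _ => hP⟩
    · obtain ⟨u, hu⟩ := (G.trans s a).support_nonempty
      exact ⟨u, hu, fun h' => absurd h' h⟩
  exact ⟨fun s a => (this s a).choose, fun s a => (this s a).choose_spec⟩

/-- A play satisfies the constraint that `w (k + 1) ∈ T (w k)` whenever the coalition `C` can force
this. -/
def forced (C : ATLQuantifier) (T : S → Set S) (s : S) : Set (ℕ → S) :=
  {w | w 0 = s ∧ ∀ k, w k ∈ G.pre C (T (w k)) → w (k + 1) ∈ T (w k)}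

theorem mem_dest_of_mem_outcome {s : S} {σ : G.Strategy₁} {τ : G.Strategyₚ} {w : ℕ → S}
    (hw : w ∈ G.outcome s σ τ) (k : ℕ) : ∃ a ∈ G.mov (w k), a ∈ (σ.act k (playPrefix w k)).support ∧
      w (k + 1) ∈ (τ.move k (playPrefix w k) a).support ∧ w (k + 1) ∈ G.dest (w k) a := by
  obtain ⟨a, ha, h1, h2⟩ := hw.2 k
  have h2' := (PMF.apply_pos_iff _ _).1 h2
  exact ⟨a, ha, (PMF.apply_pos_iff _ _).1 h1, h2', τ.support_subset k (playPrefix w k) a ha h2'⟩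

/-- One-step choices combine into a memoryless strategy: at each state the coalition picks actions
or destinations that serve the target `T` of that state whenever it can. A suitable `T` then gives
the sufficiency half for each temporal operator. -/
theorem atlInterp_forced (C : ATLQuantifier) (T : S → Set S) (s : S) :
    G.atlInterp C s (G.forced C T s) := by
  obtain ⟨f₁, hf₁⟩ := G.exists_action fun s a => ∀ u ∈ G.dest s a, u ∈ T s
  obtain ⟨f₂, hf₂⟩ := G.exists_action fun s a => ∃ u ∈ G.dest s a, u ∈ T s
  obtain ⟨g, hg⟩ := G.exists_destination fun s _ u => u ∈ T s
  cases C
  · refine ⟨.ofAction G f₁ fun s => (hf₁ s).1, fun τ w hw => ⟨hw.1, fun k hk => ?_⟩⟩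
    obtain ⟨a, -, ha, -, hu⟩ := G.mem_dest_of_mem_outcome hw k
    obtain rfl : a = f₁ (w k) := by simpa [Strategy₁.ofAction] using ha
    exact (hf₁ (w k)).2 hk _ hu
  · refine ⟨.ofDest G g fun s a => (hg s a).1, fun σ w hw => ⟨hw.1, fun k hk => ?_⟩⟩
    obtain ⟨a, hm, -, hu, -⟩ := G.mem_dest_of_mem_outcome hw k
    have hu' : w (k + 1) = g (w k) a := by simpa [Strategyₚ.ofDest] using hu
    rw [hu']
    exact (hg (w k) a).2 (hk a hm)
  · refine ⟨.ofAction G f₂ fun s => (hf₂ s).1, .ofDest G g fun s a => (hg s a).1,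
      fun w hw => ⟨hw.1, fun k hk => ?_⟩⟩
    obtain ⟨a, -, ha, hu, -⟩ := G.mem_dest_of_mem_outcome hw k
    obtain rfl : a = f₂ (w k) := by simpa [Strategy₁.ofAction] using ha
    have hu' : w (k + 1) = g (w k) (f₂ (w k)) := by simpa [Strategyₚ.ofDest] using hu
    rw [hu']
    exact (hg (w k) _).2 ((hf₂ (w k)).2 hk)
  · intro σ τ w hw
    refine ⟨hw.1, fun k hk => ?_⟩
    obtain ⟨a, hm, -, -, hu⟩ := G.mem_dest_of_mem_outcome hw k
    exact hk a hm _ hu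

theorem atlInterp_mono {C : ATLQuantifier} {s : S} {E E' : Set (ℕ → S)} (h : E ⊆ E')
    (hE : G.atlInterp C s E) : G.atlInterp C s E' := by
  cases C
  · exact hE.imp fun σ hσ τ => (hσ τ).trans h
  · exact hE.imp fun τ hτ σ => (hτ σ).trans h
  · exact hE.imp fun σ => Exists.imp fun τ hτ => hτ.trans h
  · exact fun σ τ => (hE σ τ).trans h

theorem exists_mem_outcome (s : S) (σ : G.Strategy₁) (τ : G.Strategyₚ) :
    ∃ w, w ∈ G.outcome s σ τ := by
  have hstep : ∀ n (h : History S n), ∃ u, ∃ a ∈ G.mov h.last, 0 < σ.act n h a ∧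
      0 < τ.move n h a u := by
    intro n h
    obtain ⟨a, ha⟩ := (σ.act n h).support_nonempty
    obtain ⟨u, hu⟩ := (τ.move n h a).support_nonempty
    exact ⟨u, a, σ.support_subset n h ha, (PMF.apply_pos_iff _ _).2 ha,
      (PMF.apply_pos_iff _ _).2 hu⟩
  choose next hnext using hstep
  let hist : ∀ n, History S n :=
    fun n => Nat.rec (motive := fun n => History S n) (fun _ => s) (fun n h => h.snoc (next n h)) n
  have hpre : ∀ n, playPrefix (fun n => (hist n).last) n = hist n := by
    intro n
    induction n with
    | zero =>
      funext ⟨i, hi⟩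
      obtain rfl : i = 0 := by simpa using hi
      rfl
    | succ n ih =>
      rw [playPrefix_succ, ih]
      simp [hist]
  refine ⟨fun n => (hist n).last, rfl, fun k => ?_⟩
  rw [hpre]
  have : (hist (k + 1)).last = next k (hist k) := by simp [hist]
  have hk := hnext k (hist k)
  rw [← this] at hk
  exact hk

/-- Strategies of opposing coalitions, played against each other, have a common outcome. -/
theorem exists_mem_of_atlInterp {C : ATLQuantifier} {s : S} {E E' : Set (ℕ → S)}
    (hE : G.atlInterp C s E) (hE' : G.atlInterp C.dual s E') : ∃ w ∈ E, w ∈ E' := by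
  cases C
  · obtain ⟨σ, hσ⟩ := hE
    obtain ⟨τ, hτ⟩ := hE'
    obtain ⟨w, hw⟩ := G.exists_mem_outcome s σ τ
    exact ⟨w, hσ τ hw, hτ σ hw⟩
  · obtain ⟨τ, hτ⟩ := hE
    obtain ⟨σ, hσ⟩ := hE'
    obtain ⟨w, hw⟩ := G.exists_mem_outcome s σ τ
    exact ⟨w, hτ σ hw, hσ τ hw⟩
  · obtain ⟨σ, τ, h⟩ := hE
    obtain ⟨w, hw⟩ := G.exists_mem_outcome s σ τ
    exact ⟨w, h hw, hE' σ τ hw⟩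
  · obtain ⟨σ, τ, h⟩ := hE'
    obtain ⟨w, hw⟩ := G.exists_mem_outcome s σ τ
    exact ⟨w, hE σ τ hw, h hw⟩

/-- Whatever the targets `T`, some play in `E` meets them only where `C` can force this. -/
def Evades (C : ATLQuantifier) (s : S) (E : Set (ℕ → S)) : Prop :=
  ∀ T : S → Set S, ∃ w ∈ E, w 0 = s ∧ ∀ k, w (k + 1) ∈ T (w k) → w k ∈ G.pre C (T (w k))

theorem evades_of_forced {C : ATLQuantifier} {s : S} {E : Set (ℕ → S)}
    (h : ∀ T, ∃ w ∈ E, w ∈ G.forced C.dual T s) : G.Evades C s E := by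
  intro T
  obtain ⟨w, hw, h0, hk⟩ := h fun u => (T u)ᶜ
  refine ⟨w, hw, h0, fun k hT => ?_⟩
  by_contra hc
  exact hk k (G.notMem_pre_iff.1 hc) hT

/-- `Evades` is all that the necessity halves need. Positive probability implies it as well, so both
semantics share the arguments for next and until. -/
theorem evades_of_atlInterp {C : ATLQuantifier} {s : S} {E : Set (ℕ → S)}
    (hE : G.atlInterp C s E) : G.Evades C s E :=
  G.evades_of_forced fun T => G.exists_mem_of_atlInterp hE (G.atlInterp_forced C.dual T s)

theorem Evades.mem_of_stateEvent {C : ATLQuantifier} {s : S} {X : Set S}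
    (h : G.Evades C s (stateEvent X)) : s ∈ X := by
  obtain ⟨w, hw, rfl, -⟩ := h fun _ => Set.univ
  exact hw

theorem Evades.mem_of_nextEvent {C : ATLQuantifier} {s : S} {X : Set S}
    (h : G.Evades C s (nextEvent X)) : s ∈ G.pre C X := by
  obtain ⟨w, hw, rfl, hk⟩ := h fun _ => X
  exact hk 0 hw

/-- The states from which the coalition `C` can force "`X` until `Y`". -/
def untilSet (C : ATLQuantifier) (X Y : Set S) : Set S := iterSup fun Z => Y ∪ X ∩ G.pre C Z

variable {G} in
theorem FinitelyBranching.incContinuous_untilSet [Finite A] (hG : G.FinitelyBranching)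
    (C : ATLQuantifier) (X Y : Set S) : IncContinuous fun Z => Y ∪ X ∩ G.pre C Z :=
  (IncContinuous.const Y).union ((G.incContinuous_pre hG C).const_inter X)

theorem Evades.mem_untilSet [Finite A] (hG : G.FinitelyBranching) {C : ATLQuantifier} {s : S}
    {X Y : Set S} (h : G.Evades C s (untilEvent X Y)) : s ∈ G.untilSet C X Y := by
  have hsub := (hG.incContinuous_untilSet C X Y).apply_iterSup_subset
  obtain ⟨w, hw, rfl, hk⟩ := h fun _ => G.untilSet C X Y
  exact mem_of_mem_untilEvent hw (fun u hu => hsub (.inl hu))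
    fun k hX hL => hsub (.inr ⟨hX, hk k hL⟩)

theorem atlInterp_stateEvent_iff {C : ATLQuantifier} {s : S} {X : Set S} :
    G.atlInterp C s (stateEvent X) ↔ s ∈ X := by
  refine ⟨fun h => (G.evades_of_atlInterp h).mem_of_stateEvent, fun h => ?_⟩
  refine G.atlInterp_mono ?_ (G.atlInterp_forced C (fun _ => X) s)
  rintro w ⟨rfl, -⟩
  exact h

theorem atlInterp_nextEvent_iff {C : ATLQuantifier} {s : S} {X : Set S} :
    G.atlInterp C s (nextEvent X) ↔ s ∈ G.pre C X := by
  refine ⟨fun h => (G.evades_of_atlInterp h).mem_of_nextEvent, fun h => ?_⟩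
  refine G.atlInterp_mono ?_ (G.atlInterp_forced C (fun _ => X) s)
  rintro w ⟨rfl, hk⟩
  exact hk 0 h

theorem atlInterp_untilEvent_iff [Finite A] (hG : G.FinitelyBranching) {C : ATLQuantifier} {s : S}
    {X Y : Set S} : G.atlInterp C s (untilEvent X Y) ↔ s ∈ G.untilSet C X Y := by
  refine ⟨fun h => (G.evades_of_atlInterp h).mem_untilSet G hG, fun h => ?_⟩
  obtain ⟨r, hr⟩ := (hG.incContinuous_untilSet C X Y).exists_rank
  refine G.atlInterp_mono ?_
    (G.atlInterp_forced C (fun s => {u | u ∈ G.untilSet C X Y ∧ r u < r s}) s)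
  rintro w ⟨rfl, hk⟩
  refine mem_untilEvent_of_rank (r := r) h fun k hL => ?_
  rcases hr _ hL with hY | ⟨hX, hp⟩
  · exact .inl hY
  · exact .inr ⟨hX, hk k hp⟩

theorem atlInterp_waitEvent_iff [Finite A] (hG : G.FinitelyBranching) {C : ATLQuantifier} {s : S}
    {X Y : Set S} : G.atlInterp C s (waitEvent X Y) ↔ s ∉ G.untilSet C.dual Yᶜ Xᶜ := by
  have hcont := hG.incContinuous_untilSet C.dual Yᶜ Xᶜ
  constructor
  · intro h hs
    obtain ⟨r, hr⟩ := hcont.exists_rank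
    -- For complemented targets, evasion means that the play moves to a smaller rank wherever the
    -- opponents can force this.
    obtain ⟨w, hw, rfl, hk⟩ := G.evades_of_atlInterp h
      fun s => {u | u ∈ G.untilSet C.dual Yᶜ Xᶜ ∧ r u < r s}ᶜ
    have hu : w ∈ untilEvent Yᶜ Xᶜ := by
      refine mem_untilEvent_of_rank (r := r) hs fun k hL => ?_
      rcases hr _ hL with hX | ⟨hY, hp⟩
      · exact .inl hX
      · refine .inr ⟨hY, ?_⟩
        by_contra hc
        have := hk k hc
        rw [pre_compl] at this
        exact this hp
    obtain ⟨j, hj, hi⟩ := hu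
    rcases hw with hw | ⟨i, hY, hX⟩
    · exact hj (hw j)
    · rcases lt_or_ge i j with h' | h'
      · exact hi i h' hY
      · exact hj (hX j h')
  · intro hs
    have hX : ∀ u ∉ G.untilSet C.dual Yᶜ Xᶜ, u ∈ X := fun u hu => by
      by_contra hc
      exact hu (hcont.apply_iterSup_subset (.inl hc))
    -- Outside the opponents' until set and before `Y` is met, `C` can force the next state to be
    -- outside again.
    refine G.atlInterp_mono ?_ (G.atlInterp_forced C (fun _ => (G.untilSet C.dual Yᶜ Xᶜ)ᶜ) s)
    rintro w ⟨rfl, hk⟩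
    by_cases hex : ∃ j, w j ∈ Y ∧ ∀ i ≤ j, w i ∉ G.untilSet C.dual Yᶜ Xᶜ
    · obtain ⟨j, hY, hi⟩ := hex
      exact .inr ⟨j, hY, fun i hij => hX _ (hi i hij)⟩
    · push Not at hex
      have hall : ∀ n, ∀ i ≤ n, w i ∉ G.untilSet C.dual Yᶜ Xᶜ := by
        intro n
        induction n with
        | zero =>
          intro i hi
          rwa [Nat.le_zero.1 hi]
        | succ n ih =>
          intro i hi
          rcases hi.lt_or_eq with h' | rfl
          · exact ih i (Nat.lt_succ_iff.1 h')
          · refine hk n ?_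
            rw [pre_compl]
            intro hp
            have hY : w n ∉ Y := fun hY => by
              obtain ⟨i, hi, hL⟩ := hex n hY
              exact ih i hi hL
            exact ih n le_rfl (hcont.apply_iterSup_subset (.inr ⟨hY, hp⟩))
      exact .inl fun j => hX _ (hall j j le_rfl)

end MDP

/-! ### Next-equivalence and ATL equivalence -/

/-- `X` is a union of classes of the relation `R`. -/
def Saturated {S : Type*} (R : Set (S × S)) (X : Set S) : Prop :=
  ∀ s t, (s, t) ∈ R → (s ∈ X ↔ t ∈ X)

namespace Saturated

variable {S : Type*} {R : Set (S × S)} {X Y : Set S}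

theorem univ : Saturated R Set.univ := fun _ _ _ => by simp

theorem empty : Saturated R ∅ := fun _ _ _ => by simp

theorem compl (hX : Saturated R X) : Saturated R Xᶜ := fun s t h => not_congr (hX s t h)

theorem union (hX : Saturated R X) (hY : Saturated R Y) : Saturated R (X ∪ Y) :=
  fun s t h => or_congr (hX s t h) (hY s t h)

theorem inter (hX : Saturated R X) (hY : Saturated R Y) : Saturated R (X ∩ Y) :=
  fun s t h => and_congr (hX s t h) (hY s t h)

theorem iUnion {W : ℕ → Set S} (hW : ∀ n, Saturated R (W n)) : Saturated R (⋃ n, W n) :=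
  fun s t h => by simp only [Set.mem_iUnion]; exact exists_congr fun n => hW n s t h

theorem iterSup {F : Set S → Set S} (hF : ∀ Z, Saturated R Z → Saturated R (F Z)) :
    Saturated R (iterSup F) :=
  iterSup_induction empty hF fun _ => iUnion

end Saturated

/-- The ATL quantifier that agrees with a quantifier of QRCTL on reachability events. -/
def PosQuantifier.toATL : PosQuantifier → ATLQuantifier
  | existsPos => .both
  | forallPos => .p

namespace MDP

variable {AP S A : Type*} (G : MDP AP S A)

theorem nonempty_strategy₁ : Nonempty G.Strategy₁ := by
  obtain ⟨f, hf⟩ := G.exists_action fun _ _ => True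
  exact ⟨.ofAction G f fun s => (hf s).1⟩

section pos

variable [Countable S]

/-- An event of positive probability contains an outcome under `natural`. For `∃^pos` every outcome
obeys what the empty coalition forces; for `∀^pos` player 1 may be given the forcing strategy. -/
theorem evades_of_posInterp {Q : PosQuantifier} {s : S} {E : Set (ℕ → S)}
    (hE : G.posInterp Q s E) : G.Evades Q.toATL s E := by
  refine G.evades_of_forced fun T => ?_
  cases Q
  · obtain ⟨σ, hσ⟩ := hE
    obtain ⟨w, hw, hout⟩ := G.exists_mem_outcome_of_prob_pos s σ hσ
    exact ⟨w, hw, G.atlInterp_forced .none T s σ G.natural hout⟩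
  · obtain ⟨σ, hσ⟩ := G.atlInterp_forced .one T s
    obtain ⟨w, hw, hout⟩ := G.exists_mem_outcome_of_prob_pos s σ (hE σ)
    exact ⟨w, hw, hσ G.natural hout⟩

theorem posInterp_stateEvent_iff {Q : PosQuantifier} {s : S} {X : Set S} :
    G.posInterp Q s (stateEvent X) ↔ s ∈ X := by
  cases Q
  · simp only [posInterp, prob_stateEvent_pos_iff, exists_const_iff, G.nonempty_strategy₁, true_and]
  · have := G.nonempty_strategy₁
    simp only [posInterp, prob_stateEvent_pos_iff, forall_const]

theorem posInterp_nextEvent_iff {Q : PosQuantifier} {s : S} {X : Set S} :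
    G.posInterp Q s (nextEvent X) ↔ s ∈ G.pre Q.toATL X := by
  refine ⟨fun h => (G.evades_of_posInterp h).mem_of_nextEvent, fun h => ?_⟩
  cases Q
  · obtain ⟨f, hf⟩ := G.exists_action fun s a => ∃ u ∈ G.dest s a, u ∈ X
    refine ⟨.ofAction G f fun s => (hf s).1, (G.prob_nextEvent_pos_iff s _ X).2
      ⟨f s, by simp [Strategy₁.ofAction, History.last], (hf s).2 h⟩⟩
  · intro σ
    obtain ⟨a, ha⟩ := (σ.act 0 fun _ => s).support_nonempty
    exact (G.prob_nextEvent_pos_iff s σ X).2 ⟨a, ha, h a (σ.support_subset 0 _ ha)⟩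

theorem sem_qNext (Q : PosQuantifier) (f : Formula AP PosQuantifier) :
    G.sem G.posInterp (.qNext Q f) = G.pre Q.toATL (G.sem G.posInterp f) := by
  simp only [sem, posInterp_nextEvent_iff]
  rfl

/-- Reachability is decided by finite prefixes, hence by supports: the rank of the ATL fixed point
also yields positive probability. -/
theorem posInterp_untilEvent_iff [Finite A] (hG : G.FinitelyBranching) {Q : PosQuantifier} {s : S}
    {X Y : Set S} : G.posInterp Q s (untilEvent X Y) ↔ s ∈ G.untilSet Q.toATL X Y := by
  refine ⟨fun h => (G.evades_of_posInterp h).mem_untilSet G hG, fun h => ?_⟩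
  obtain ⟨r, hr⟩ := (hG.incContinuous_untilSet Q.toATL X Y).exists_rank
  cases Q
  · obtain ⟨f, hf⟩ := G.exists_action fun s a => ∃ u ∈ G.dest s a,
      u ∈ G.untilSet .both X Y ∧ r u < r s
    refine ⟨.ofAction G f fun s => (hf s).1, G.prob_untilEvent_pos s _ (r := r) h
      fun n h hL hY => ?_⟩
    rcases hr _ hL with hY' | ⟨hX, hp⟩
    · exact absurd hY' hY
    · exact ⟨hX, f h.last, by simp [Strategy₁.ofAction], (hf h.last).2 hp⟩
  · refine fun σ => G.prob_untilEvent_pos s σ (r := r) h fun n h hL hY => ?_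
    rcases hr _ hL with hY' | ⟨hX, hp⟩
    · exact absurd hY' hY
    · obtain ⟨a, ha⟩ := (σ.act n h).support_nonempty
      exact ⟨hX, a, ha, hp a (σ.support_subset n h ha)⟩

/-- A relation that respects labels and predecessor operators respects the next-fragment. -/
theorem saturated_sem_of_nextOnly {R : Set (S × S)}
    (hlabel : ∀ q, Saturated R {s | q ∈ G.label s})
    (hpre : ∀ (Q : PosQuantifier) X, Saturated R X → Saturated R (G.pre Q.toATL X)) :
    ∀ f : Formula AP PosQuantifier, f.NextOnly → Saturated R (G.sem G.posInterp f)
  | .tru, _ => .univ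
  | .atom q, _ => hlabel q
  | .neg f, hf => (saturated_sem_of_nextOnly hlabel hpre f hf).compl
  | .or f g, hf =>
    (saturated_sem_of_nextOnly hlabel hpre f hf.1).union (saturated_sem_of_nextOnly hlabel hpre g hf.2)
  | .qState Z f, hf => by
    simp only [sem, posInterp_stateEvent_iff]
    exact saturated_sem_of_nextOnly hlabel hpre f hf
  | .qNext Z f, hf => by
    simp only [sem, posInterp_nextEvent_iff]
    exact hpre Z _ (saturated_sem_of_nextOnly hlabel hpre f hf)

theorem saturated_sem_posNextEquiv (f : Formula AP PosQuantifier) (hf : f.NextOnly) :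
    Saturated G.posNextEquiv (G.sem G.posInterp f) := fun _ _ h => h f hf

theorem posNextEquiv_symm {s t : S} (h : (s, t) ∈ G.posNextEquiv) : (t, s) ∈ G.posNextEquiv :=
  fun f hf => (h f hf).symm

theorem posNextEquiv_supset {R : Set (S × S)}
    (h : ∀ f : Formula AP PosQuantifier, f.NextOnly → Saturated R (G.sem G.posInterp f)) :
    R ⊆ G.posNextEquiv := fun x hx f hf => h f hf x.1 x.2 hx

/-- A conjunction separates one state from the finite set `Q`; a disjunction of these handles all of
`P`. -/
theorem exists_separating {P Q : Set S} (hP : P.Finite) (hQ : Q.Finite)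
    (h : ∀ u ∈ P, ∀ v ∈ Q, (u, v) ∉ G.posNextEquiv) :
    ∃ f : Formula AP PosQuantifier, f.NextOnly ∧ (∀ u ∈ P, u ∈ G.sem G.posInterp f) ∧
      ∀ v ∈ Q, v ∉ G.sem G.posInterp f := by
  have h1 : ∀ u v, (u, v) ∉ G.posNextEquiv → ∃ f : Formula AP PosQuantifier, f.NextOnly ∧
      u ∈ G.sem G.posInterp f ∧ v ∉ G.sem G.posInterp f := by
    intro u v huv
    obtain ⟨f, hfne⟩ := not_forall.1 huv
    obtain ⟨hf, hne⟩ := Classical.not_imp.1 hfne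
    by_cases hu : u ∈ G.sem G.posInterp f
    · exact ⟨f, hf, hu, fun hv => hne (iff_of_true hu hv)⟩
    · refine ⟨.neg f, hf, hu, fun hv => hne (iff_of_false hu hv)⟩
  have h2 : ∀ u, (∀ v ∈ Q, (u, v) ∉ G.posNextEquiv) → ∃ f : Formula AP PosQuantifier, f.NextOnly ∧
      u ∈ G.sem G.posInterp f ∧ ∀ v ∈ Q, v ∉ G.sem G.posInterp f := by
    intro u
    clear h
    induction Q, hQ using Set.Finite.induction_on with
    | empty => exact fun _ => ⟨.tru, trivial, trivial, by simp⟩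
    | @insert v Q _ _ ih =>
      intro hu
      obtain ⟨f, hf, hfu, hfQ⟩ := ih fun v hv => hu v (.inr hv)
      obtain ⟨g, hg, hgu, hgv⟩ := h1 u v (hu v (.inl rfl))
      refine ⟨.neg (.or (.neg f) (.neg g)), ⟨hf, hg⟩, ?_, ?_⟩
      · rintro (h | h)
        · exact h hfu
        · exact h hgu
      · rintro x (rfl | hx) hc
        · exact hc (.inr hgv)
        · exact hc (.inl (hfQ x hx))
  induction P, hP using Set.Finite.induction_on with
  | empty => exact ⟨.neg .tru, trivial, by simp, fun _ _ h => h trivial⟩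
  | @insert u P _ _ ih =>
    obtain ⟨f, hf, hfu, hfQ⟩ := ih fun u hu => h u (.inr hu)
    obtain ⟨g, hg, hgu, hgv⟩ := h2 u (h u (.inl rfl))
    refine ⟨.or f g, ⟨hf, hg⟩, ?_, ?_⟩
    · rintro x (rfl | hx)
      · exact .inr hgu
      · exact .inl (hfu x hx)
    · rintro x hx (hc | hc)
      · exact hfQ x hx hc
      · exact hgv x hx hc

-- If `s` can force `X` and `t` cannot, finitely many successors witness this. A formula `f`
-- separating them gives `∃^pos ○ f` (for `both`) or `∀^pos ○ ¬f` (for `one`), on which `s` and `t`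
-- disagree. The other two coalitions follow by duality.
variable {G} in
theorem FinitelyBranching.saturated_pre [Finite A] (hG : G.FinitelyBranching) {X : Set S}
    (hX : Saturated G.posNextEquiv X) (C : ATLQuantifier) :
    Saturated G.posNextEquiv (G.pre C X) := by
  have hsep : ∀ {X}, Saturated G.posNextEquiv X → ∀ {u v}, u ∈ X → v ∉ X →
      (u, v) ∉ G.posNextEquiv := fun hX u v hu hv huv => hv ((hX u v huv).1 hu)
  have hboth : ∀ {X}, Saturated G.posNextEquiv X → Saturated G.posNextEquiv (G.pre .both X) := by
    intro X hX
    have : ∀ s t, (s, t) ∈ G.posNextEquiv → s ∈ G.pre .both X → t ∈ G.pre .both X := by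
      rintro s t hst ⟨a, ha, u, hu, huX⟩
      by_contra ht
      have ht' : ∀ b ∈ G.mov t, ∀ v ∈ G.dest t b, v ∉ X := by simpa [pre] using ht
      obtain ⟨f, hf, hfu, hfQ⟩ := G.exists_separating (Set.finite_singleton u)
        ((Set.toFinite (G.mov t)).biUnion (hG t)) (by
          rintro _ rfl v hv
          obtain ⟨b, hb, hv⟩ := Set.mem_iUnion₂.1 hv
          exact hsep hX huX (ht' b hb v hv))
      have hst' := hst (.qNext .existsPos f) hf
      rw [sem_qNext] at hst'
      obtain ⟨b, hb, v, hv, hvf⟩ := hst'.1 ⟨a, ha, u, hu, hfu u rfl⟩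
      exact hfQ v (Set.mem_iUnion₂.2 ⟨b, hb, hv⟩) hvf
    exact fun s t hst => ⟨this s t hst, this t s (G.posNextEquiv_symm hst)⟩
  have hone : ∀ {X}, Saturated G.posNextEquiv X → Saturated G.posNextEquiv (G.pre .one X) := by
    intro X hX
    have : ∀ s t, (s, t) ∈ G.posNextEquiv → s ∈ G.pre .one X → t ∈ G.pre .one X := by
      rintro s t hst ⟨a, ha, hu⟩
      by_contra ht
      have ht' : ∀ b : G.mov t, ∃ v ∈ G.dest t b, v ∉ X := by simpa [pre] using ht
      choose v hv hvX using ht'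
      obtain ⟨f, hf, hfu, hfQ⟩ := G.exists_separating (hG s a ha) (Set.finite_range v) (by
        rintro u hus _ ⟨b, rfl⟩
        exact hsep hX (hu u hus) (hvX b))
      have hst' := hst (.qNext .forallPos (.neg f)) hf
      rw [sem_qNext] at hst'
      obtain ⟨u, hud, hun⟩ := hst'.2 (fun b (hb : b ∈ G.mov t) => ⟨v ⟨b, hb⟩, hv ⟨b, hb⟩, hfQ _ ⟨_, rfl⟩⟩) a ha
      exact hun (hfu u hud)
    exact fun s t hst => ⟨this s t hst, this t s (G.posNextEquiv_symm hst)⟩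
  cases C
  · exact hone hX
  · rw [← compl_compl X, pre_compl]
    exact (hone hX.compl).compl
  · exact hboth hX
  · rw [← compl_compl X, pre_compl]
    exact (hboth hX.compl).compl

variable {G} in
theorem FinitelyBranching.saturated_untilSet [Finite A] (hG : G.FinitelyBranching) {X Y : Set S}
    (hX : Saturated G.posNextEquiv X) (hY : Saturated G.posNextEquiv Y) (C : ATLQuantifier) :
    Saturated G.posNextEquiv (G.untilSet C X Y) :=
  .iterSup fun _ hZ => hY.union (hX.inter (hG.saturated_pre hZ C))

variable {G} in
theorem FinitelyBranching.saturated_sem_atlInterp [Finite A] (hG : G.FinitelyBranching) :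
    ∀ f : Formula AP ATLQuantifier, Saturated G.posNextEquiv (G.sem G.atlInterp f)
  | .tru => .univ
  | .atom q => G.saturated_sem_posNextEquiv (.atom q) trivial
  | .neg f => (hG.saturated_sem_atlInterp f).compl
  | .or f g => (hG.saturated_sem_atlInterp f).union (hG.saturated_sem_atlInterp g)
  | .qState Z f => by
    simp only [sem, atlInterp_stateEvent_iff]
    exact hG.saturated_sem_atlInterp f
  | .qNext Z f => by
    simp only [sem, atlInterp_nextEvent_iff]
    exact hG.saturated_pre (hG.saturated_sem_atlInterp f) Z
  | .qUntil Z f g => by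
    simp only [sem, G.atlInterp_untilEvent_iff hG]
    exact hG.saturated_untilSet (hG.saturated_sem_atlInterp f) (hG.saturated_sem_atlInterp g) Z
  | .qWait Z f g => by
    simp only [sem, G.atlInterp_waitEvent_iff hG]
    exact (hG.saturated_untilSet (hG.saturated_sem_atlInterp g).compl
      (hG.saturated_sem_atlInterp f).compl Z.dual).compl

theorem exists_atl_formula : ∀ f : Formula AP PosQuantifier, f.NextOnly →
    ∃ g : Formula AP ATLQuantifier, G.sem G.atlInterp g = G.sem G.posInterp f
  | .tru, _ => ⟨.tru, rfl⟩
  | .atom q, _ => ⟨.atom q, rfl⟩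
  | .neg f, hf => by
    obtain ⟨f', hf'⟩ := exists_atl_formula f hf
    exact ⟨.neg f', by simp only [sem, hf']⟩
  | .or f g, hf => by
    obtain ⟨f', hf'⟩ := exists_atl_formula f hf.1
    obtain ⟨g', hg'⟩ := exists_atl_formula g hf.2
    exact ⟨.or f' g', by simp only [sem, hf', hg']⟩
  | .qState Z f, hf => by
    obtain ⟨f', hf'⟩ := exists_atl_formula f hf
    exact ⟨f', by simp only [sem, posInterp_stateEvent_iff, hf']; rfl⟩
  | .qNext Z f, hf => by
    obtain ⟨f', hf'⟩ := exists_atl_formula f hf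
    exact ⟨.qNext Z.toATL f',
      by simp only [sem, posInterp_nextEvent_iff, atlInterp_nextEvent_iff, hf']⟩

variable {G} in
theorem FinitelyBranching.posNextEquiv_eq_atlEquiv [Finite A] (hG : G.FinitelyBranching) :
    G.posNextEquiv = G.atlEquiv := by
  ext ⟨s, t⟩
  constructor
  · exact fun h f => hG.saturated_sem_atlInterp f s t h
  · intro h f hf
    obtain ⟨g, hg⟩ := G.exists_atl_formula f hf
    rw [← hg]
    exact h g

theorem posEquiv_subset_posNextEquiv : G.posEquiv ⊆ G.posNextEquiv :=
  fun _ h f _ => h f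

end pos

end MDP

/-! ### Finite MDPs: wait-for with positive probability -/

namespace MDP

variable {AP S A : Type*} (G : MDP AP S A)

theorem finitelyBranching_of_finite [Finite S] : G.FinitelyBranching :=
  fun _ _ _ => Set.toFinite _

theorem exists_pos_le_trans [Finite S] [Finite A] :
    ∃ p : ℝ, 0 < p ∧ p ≤ 1 ∧ ∀ s a, ∀ u ∈ G.dest s a, ENNReal.ofReal p ≤ G.trans s a u := by
  classical
  rcases isEmpty_or_nonempty (S × A × S) with hE | hE
  · exact ⟨1, one_pos, le_rfl, fun s a u _ => (hE.false (s, a, u)).elim⟩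
  let f : S × A × S → ℝ := fun x =>
    if x.2.2 ∈ G.dest x.1 x.2.1 then (G.trans x.1 x.2.1 x.2.2).toReal else 1
  have hle : ∀ s a u, G.trans s a u ≠ ∞ := fun s a u => (G.trans s a).apply_ne_top u
  obtain ⟨x, hx⟩ := Finite.exists_min f
  refine ⟨f x, ?_, ?_, fun s a u hu => ?_⟩
  · simp only [f]
    split_ifs with h
    · exact ENNReal.toReal_pos h (hle _ _ _)
    · exact one_pos
  · simp only [f]
    split_ifs
    · exact ENNReal.toReal_le_of_le_ofReal zero_le_one (by simpa using PMF.coe_le_one _ _)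
    · exact le_rfl
  · have := hx (s, a, u)
    simp only [f, if_pos hu] at this
    exact ENNReal.ofReal_le_of_le_toReal this

/-- "`X` wait-for `Y`" has positive probability from states with a rank that is never increased or
can be decreased. -/
theorem prob_waitEvent_pos_of_rank [Finite S] [Finite A] {s : S} {σ : G.Strategy₁} {X Y H : Set S}
    {r : S → ℕ} (hs : s ∈ H) (hHX : H ⊆ X)
    (hH : ∀ n (h : History S n), h.last ∈ H → h.last ∉ Y → ∀ a ∈ (σ.act n h).support,
      (∀ u ∈ G.dest h.last a, u ∈ H ∧ r u ≤ r h.last) ∨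
        ∃ u ∈ G.dest h.last a, u ∈ H ∧ r u < r h.last) :
    0 < G.prob s σ (waitEvent X Y) := by
  classical
  obtain ⟨p, hp0, hp1, hp⟩ := G.exists_pos_le_trans
  set q := ENNReal.ofReal p
  have hq0 : 0 < q := ENNReal.ofReal_pos.2 hp0
  have hq1 : q ≤ 1 := ENNReal.ofReal_le_one.2 hp1
  -- If the rank cannot rise, `q ^ r` does not fall. Otherwise a descent of probability at least `q`
  -- alone contributes at least `q * q ^ (r - 1)`.
  let v : S → ℝ≥0∞ := fun u => if u ∈ H then q ^ r u else 0
  have hvs : 0 < v s := by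
    simp only [v, if_pos hs]
    exact ENNReal.pow_pos hq0 _
  refine hvs.trans_le (G.le_prob_waitEvent s σ (fun u => ?_) (fun u hu => ?_) ?_)
  · simp only [v]
    split_ifs
    · exact pow_le_one₀ zero_le hq1
    · exact zero_le
  · exact if_neg fun h => hu (hHX h)
  · intro n h _ hY a ha
    by_cases hl : h.last ∈ H
    · have hvl : v h.last = q ^ r h.last := if_pos hl
      rw [hvl]
      rcases hH n h hl hY a ha with hall | ⟨u, hu, huH, hlt⟩
      · refine PMF.le_tsum_mul _ fun u hu => ?_
        simp only [v, if_pos (hall u hu).1]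
        exact pow_le_pow_of_le_one zero_le hq1 (hall u hu).2
      · refine le_trans ?_ (ENNReal.le_tsum u)
        simp only [v, if_pos huH]
        calc q ^ r h.last ≤ q ^ (r u + 1) := pow_le_pow_of_le_one zero_le hq1 hlt
          _ = q * q ^ r u := pow_succ' _ _
          _ ≤ _ := mul_le_mul_left (hp _ _ _ hu) _
    · have : v h.last = 0 := if_neg hl
      rw [this]
      exact zero_le

/-- "`X` wait-for `Y`" is a null event if a rank can decrease in each step until `X` is left, and `Y`
is not met. -/
theorem prob_waitEvent_eq_zero_of_rank [Finite S] [Finite A] {s : S} {σ : G.Strategy₁}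
    {X Y H : Set S} {r : S → ℕ} (hs : s ∈ H) (hHY : ∀ u ∈ H, u ∈ X → u ∉ Y)
    (hH : ∀ n (h : History S n), h.last ∈ H → h.last ∈ X → ∀ a ∈ (σ.act n h).support,
      (∀ u ∈ G.dest h.last a, u ∈ H) ∧ ∃ u ∈ G.dest h.last a, u ∉ X ∨ r u < r h.last) :
    G.prob s σ (waitEvent X Y) = 0 := by
  classical
  obtain ⟨p, hp0, hp1, hp⟩ := G.exists_pos_le_trans
  -- The potential is `1 - θ ^ ρ`, with `ρ = 0` off `X`. A descent of probability at least `p` makes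
  -- the mean of `θ ^ ρ` at least `p * θ ^ (k - 1) = 2 * θ ^ k`, and `1 - 2θ^k ≤ (1 - θ^M)(1 - θ^k)`
  -- is the required contraction.
  set θ := p / 2 with hθ
  have hθ0 : 0 < θ := by positivity
  have hθ1 : θ < 1 := by linarith
  let ρ : S → ℕ := fun u => if u ∈ X then r u + 1 else 0
  obtain ⟨M, hM⟩ : ∃ M, ∀ u, ρ u ≤ M := by
    obtain ⟨M, hM⟩ := (Set.finite_range ρ).bddAbove
    exact ⟨M, fun u => hM ⟨u, rfl⟩⟩
  have hpow : ∀ k, θ ^ k ≤ 1 := fun k => pow_le_one₀ hθ0.le hθ1.le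
  let v : S → ℝ≥0∞ := fun u => if u ∈ H then ENNReal.ofReal (1 - θ ^ ρ u) else ∞
  refine G.prob_waitEvent_eq_zero s σ (c := ENNReal.ofReal (1 - θ ^ M))
    (m := ENNReal.ofReal (1 - θ)) (v := v) ?_ ?_ ?_ ?_ ?_ ?_
  · rw [ENNReal.ofReal_lt_one]
    linarith [pow_pos hθ0 M]
  · exact (ENNReal.ofReal_pos.2 (by linarith)).ne'
  · intro u hu
    simp only [v]
    split_ifs
    · refine ENNReal.ofReal_le_ofReal (sub_le_sub_left ?_ 1)
      simp only [ρ, if_pos hu]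
      exact pow_le_of_le_one hθ0.le hθ1.le (Nat.succ_ne_zero _)
    · exact le_top
  · exact fun u hX hY => if_neg fun hu => hHY u hu hX hY
  · simp [v, if_pos hs]
  · intro n h hX a ha
    by_cases hl : h.last ∈ H
    · obtain ⟨hall, u₀, hu₀, hdec⟩ := hH n h hl hX a ha
      set k := ρ h.last with hk
      have hvl : v h.last = ENNReal.ofReal (1 - θ ^ k) := if_pos hl
      have hρ : ρ u₀ + 1 ≤ k := by
        simp only [hk, ρ, if_pos hX]
        split_ifs with h'
        · have := hdec.resolve_left (not_not.2 h')
          omega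
        · omega
      let z : S → ℝ≥0∞ := fun u => ENNReal.ofReal (θ ^ ρ u)
      have hvz : ∀ u ∈ G.dest h.last a, v u + z u = 1 := by
        intro u hu
        simp only [v, if_pos (hall u hu), z]
        rw [← ENNReal.ofReal_add (by linarith [hpow (ρ u)]) (by positivity)]
        simp
      have hsum : ∑' u, G.trans h.last a u * v u + ∑' u, G.trans h.last a u * z u ≤ 1 := by
        rw [← ENNReal.tsum_add]
        simp_rw [← mul_add]
        exact PMF.tsum_mul_le _ fun u hu => (hvz u hu).le
      have hz : ENNReal.ofReal (2 * θ ^ k) ≤ ∑' u, G.trans h.last a u * z u := by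
        refine le_trans ?_ (ENNReal.le_tsum u₀)
        refine le_trans ?_ (mul_le_mul_left (hp _ _ _ hu₀) _)
        simp only [z]
        rw [← ENNReal.ofReal_mul hp0.le]
        refine ENNReal.ofReal_le_ofReal ?_
        have h1 : θ ^ k ≤ θ ^ (ρ u₀ + 1) := pow_le_pow_of_le_one hθ0.le hθ1.le hρ
        rw [pow_succ] at h1
        calc 2 * θ ^ k ≤ 2 * (θ ^ ρ u₀ * θ) := by linarith
          _ = p * θ ^ ρ u₀ := by rw [hθ]; ring
      have hle : ∑' u, G.trans h.last a u * v u ≤ ENNReal.ofReal (1 - 2 * θ ^ k) := by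
        rw [ENNReal.ofReal_sub _ (by positivity), ENNReal.ofReal_one]
        exact ENNReal.le_sub_of_add_le_right ENNReal.ofReal_ne_top
          ((add_le_add_right hz _).trans hsum)
      rw [hvl, ← ENNReal.ofReal_mul (by linarith [hpow M])]
      refine hle.trans (ENNReal.ofReal_le_ofReal ?_)
      have h1 : θ ^ M ≤ θ ^ k := pow_le_pow_of_le_one hθ0.le hθ1.le (hM _)
      nlinarith [mul_pos (pow_pos hθ0 M) (pow_pos hθ0 k)]
    · have : v h.last = ∞ := if_neg hl
      rw [this, ENNReal.mul_top (ENNReal.ofReal_pos.2 ?_).ne']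
      · exact le_top
      · have hX' : 1 ≤ M := (show 1 ≤ ρ h.last by simp [ρ, if_pos hX]).trans (hM _)
        have := pow_le_of_le_one hθ0.le hθ1.le (Nat.one_le_iff_ne_zero.1 hX')
        linarith

/-- The states at which player 1 can stay in `X` forever. -/
def safeSet (X : Set S) : Set S := (G.untilSet .p Set.univ Xᶜ)ᶜ

/-- The states from which "`X` wait-for `Y`" has positive probability under some strategy, for a
finite MDP. -/
def existsWaitSet (X Y : Set S) : Set S := G.untilSet .both X (X ∩ (Y ∪ G.safeSet X))

/-- Sufficiency: follow a finite path to `Y` or to the safe set, then stay safe. Necessity: outside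
`existsWaitSet`, as long as `X` lasts, `Y` is not met and every action may bring the exit from `X`
closer, so `X` is left almost surely. -/
theorem posInterp_existsPos_waitEvent_iff [Finite S] [Finite A] {s : S} {X Y : Set S} :
    G.posInterp .existsPos s (waitEvent X Y) ↔ s ∈ G.existsWaitSet X Y := by
  classical
  have hG := G.finitelyBranching_of_finite
  have hV := hG.incContinuous_untilSet .p Set.univ Xᶜ
  have hK := hG.incContinuous_untilSet .both X (X ∩ (Y ∪ G.safeSet X))
  have hKsub : _ ⊆ G.existsWaitSet X Y := hK.apply_iterSup_subset
  have hVsub : Xᶜ ∪ Set.univ ∩ G.pre .p (G.safeSet X)ᶜ ⊆ (G.safeSet X)ᶜ := by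
    rw [safeSet, compl_compl]
    exact hV.apply_iterSup_subset
  have hVX : G.safeSet X ⊆ X := fun u hu => by
    by_contra hc
    exact hVsub (.inl hc) hu
  obtain ⟨rV, hrV⟩ := hV.exists_rank
  obtain ⟨rK, hrK⟩ := hK.exists_rank
  have hKX : G.existsWaitSet X Y ⊆ X := fun u hu => by
    rcases hrK u hu with h | h
    · exact h.1
    · exact h.1
  constructor
  · rintro ⟨σ, hσ⟩
    by_contra hs
    refine hσ.ne' (G.prob_waitEvent_eq_zero_of_rank (H := (G.existsWaitSet X Y)ᶜ) (r := rV) hs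
      (fun u hu hX hY => hu (hKsub (.inl ⟨hX, .inl hY⟩))) fun n h hl hX a ha => ?_)
    have ham := σ.support_subset n h ha
    refine ⟨fun u hu huK => hl (hKsub (.inr ⟨hX, a, ham, u, hu, huK⟩)), ?_⟩
    have hnV : h.last ∉ G.safeSet X := fun hc => hl (hKsub (.inl ⟨hX, .inr hc⟩))
    rcases hrV _ (not_not.1 hnV) with hc | ⟨-, hp⟩
    · exact absurd hX hc
    · obtain ⟨u, hu, -, hlt⟩ := hp a ham
      exact ⟨u, hu, .inr hlt⟩
  · intro hs
    obtain ⟨f₁, hf₁⟩ := G.exists_action fun s a => ∀ u ∈ G.dest s a, u ∈ G.safeSet X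
    obtain ⟨f₂, hf₂⟩ := G.exists_action fun s a => ∃ u ∈ G.dest s a,
      u ∈ G.existsWaitSet X Y ∧ rK u < rK s
    -- Rank `0` on the safe set, where it stays `0`; the shift elsewhere makes entering the safe set
    -- a descent.
    refine ⟨.ofAction G (fun s => if s ∈ G.safeSet X then f₁ s else f₂ s) fun s => ?_,
      G.prob_waitEvent_pos_of_rank (H := G.existsWaitSet X Y)
        (r := fun u => if u ∈ G.safeSet X then 0 else rK u + 1) hs hKX fun n h hl hY a ha => ?_⟩
    · split_ifs
      exacts [(hf₁ s).1, (hf₂ s).1]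
    have ha' : a = if h.last ∈ G.safeSet X then f₁ h.last else f₂ h.last := by
      simpa [Strategy₁.ofAction] using ha
    by_cases hVl : h.last ∈ G.safeSet X
    · rw [if_pos hVl] at ha'
      have hstep : h.last ∈ G.pre .one (G.safeSet X) := by
        by_contra hc
        rw [notMem_pre_iff] at hc
        exact hVsub (.inr ⟨trivial, hc⟩) hVl
      refine .inl fun u hu => ?_
      have huV : u ∈ G.safeSet X := (hf₁ h.last).2 hstep u (ha' ▸ hu)
      exact ⟨hKsub (.inl ⟨hVX huV, .inr huV⟩), by simp [huV]⟩
    · rw [if_neg hVl] at ha'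
      rcases hrK _ hl with ⟨-, hc⟩ | ⟨-, hp⟩
      · exact absurd hc (by rintro (h | h); exacts [hY h, hVl h])
      · obtain ⟨u, hu, huK, hlt⟩ := (hf₂ h.last).2 hp
        refine .inr ⟨u, ha' ▸ hu, huK, ?_⟩
        simp only [if_neg hVl]
        split_ifs
        · exact Nat.succ_pos _
        · exact Nat.succ_lt_succ hlt

/-- The states with an action that surely leads to `Z` and possibly to `W`. -/
def almostPre (Z W : Set S) : Set S :=
  {s | ∃ a ∈ G.mov s, (∀ u ∈ G.dest s a, u ∈ Z) ∧ ∃ u ∈ G.dest s a, u ∈ W}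

/-- One step towards a violation of "`X` wait-for `Y`" in which `Z` is not left. -/
def violateStep (X Y Z W : Set S) : Set S := Xᶜ ∪ Yᶜ ∩ G.almostPre Z W

theorem violateStep_mono {X Y Z Z' W W' : Set S} (hZ : Z ⊆ Z') (hW : W ⊆ W') :
    G.violateStep X Y Z W ⊆ G.violateStep X Y Z' W' := by
  refine Set.union_subset_union_right _ (Set.inter_subset_inter_right _ ?_)
  rintro s ⟨a, ha, h1, u, hu, h2⟩
  exact ⟨a, ha, fun v hv => hZ (h1 v hv), u, hu, hW h2⟩

/-- The states from which "`X` wait-for `Y`" has positive probability under every strategy, for a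
finite MDP. -/
def forallWaitSet (X Y : Set S) : Set S :=
  iterSup fun B => (iterSup (G.violateStep X Y Bᶜ))ᶜ

/-- The complement is a greatest fixed point: from it player 1 can violate the wait-for almost
surely, never leaving it before the violation and possibly getting closer at each step. Inside, the
stage of the outer iteration is a rank which every action either may lower or cannot raise. -/
theorem posInterp_forallPos_waitEvent_iff [Finite S] [Finite A] {s : S} {X Y : Set S} :
    G.posInterp .forallPos s (waitEvent X Y) ↔ s ∈ G.forallWaitSet X Y := by
  have hL : ∀ Z, IncContinuous (G.violateStep X Y Z) := fun Z =>
    .of_finite fun _ _ h => G.violateStep_mono subset_rfl h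
  have hB : IncContinuous fun B => (iterSup (G.violateStep X Y Bᶜ))ᶜ :=
    .of_finite fun B B' h => Set.compl_subset_compl.2 <| iterSup_mono (hL _).mono
      fun _ => G.violateStep_mono (Set.compl_subset_compl.2 h) subset_rfl
  have hBsub : _ ⊆ G.forallWaitSet X Y := hB.apply_iterSup_subset
  constructor
  · intro hpos
    by_contra hs
    have hU : ∀ u ∉ G.forallWaitSet X Y, u ∈ iterSup (G.violateStep X Y (G.forallWaitSet X Y)ᶜ) :=
      fun u hu => not_not.1 fun hc => hu (hBsub hc)
    obtain ⟨ρ, hρ⟩ := (hL (G.forallWaitSet X Y)ᶜ).exists_rank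
    obtain ⟨f, hf⟩ := G.exists_action fun s a =>
      (∀ u ∈ G.dest s a, u ∈ (G.forallWaitSet X Y)ᶜ) ∧ ∃ u ∈ G.dest s a,
        u ∈ {v | v ∈ iterSup (G.violateStep X Y (G.forallWaitSet X Y)ᶜ) ∧ ρ v < ρ s}
    refine (hpos (.ofAction G f fun s => (hf s).1)).ne' (G.prob_waitEvent_eq_zero_of_rank
      (H := (G.forallWaitSet X Y)ᶜ) (r := ρ) hs (fun u hu hX hY => ?_) fun n h hl hX a ha => ?_)
    · rcases hρ u (hU u hu) with h | h
      · exact h hX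
      · exact h.1 hY
    · obtain rfl : a = f h.last := by simpa [Strategy₁.ofAction] using ha
      rcases hρ _ (hU _ hl) with hc | ⟨-, hp⟩
      · exact absurd hX hc
      · obtain ⟨h1, u, hu, -, hlt⟩ := (hf h.last).2 hp
        exact ⟨h1, u, hu, .inr hlt⟩
  · intro hs σ
    obtain ⟨r, hr⟩ := hB.exists_rank_iff
    have hmem : ∀ u ∈ G.forallWaitSet X Y,
        u ∉ iterSup (G.violateStep X Y {v | v ∈ G.forallWaitSet X Y ∧ r v < r u}ᶜ) :=
      fun u hu => (hr _ u).1 ⟨hu, le_rfl⟩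
    refine G.prob_waitEvent_pos_of_rank (H := G.forallWaitSet X Y) (r := r) hs (fun u hu => ?_)
      fun n h hl hY a ha => ?_
    · by_contra hX
      exact hmem u hu ((hL _).apply_iterSup_subset (.inl hX))
    -- Otherwise `a` surely avoids the states of smaller rank and may reach a state outside the set
    -- or of larger rank. That makes it a step towards violation, which the stage of `h.last`
    -- excludes.
    · by_contra! hc
      refine hmem _ hl ((hL _).apply_iterSup_subset
        (.inr ⟨hY, a, σ.support_subset n h ha, fun u hu hlt => ?_, ?_⟩))
      · exact not_lt.2 (hc.2 u hu hlt.1) hlt.2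
      · obtain ⟨u, hu, hlt⟩ := hc.1
        refine ⟨u, hu, ?_⟩
        by_contra hn
        have := (hr _ u).2 hn
        exact not_le.2 (hlt this.1) this.2

/-! ### Finite alternating MDPs -/

section alternating

variable {G} {turn : AP}

/-- With a unique destination, "surely `Z` and possibly `W`" means `Z ∩ W`; with a unique action,
the two requirements automatically concern the same action. The label `turn` tells the cases apart.
-/
theorem IsAlternating.almostPre_eq (hG : G.IsAlternating turn) (Z W : Set S) :
    G.almostPre Z W = {s | turn ∈ G.label s} ∩ G.pre .one (Z ∩ W) ∪
      {s | turn ∈ G.label s}ᶜ ∩ (G.pre .one Z ∩ G.pre .both W) := by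
  obtain ⟨S₁, Sₚ, hun, -, h1, hp⟩ := hG
  ext s
  have hs : s ∈ S₁ ∪ Sₚ := hun ▸ Set.mem_univ s
  constructor
  · rintro ⟨a, ha, hZ, u, hu, hW⟩
    by_cases ht : turn ∈ G.label s
    · have hs1 : s ∈ S₁ := hs.resolve_right fun h => (hp s h).1 ht
      obtain ⟨t, hd⟩ := (h1 s hs1).2 a ha
      refine .inl ⟨ht, a, ha, fun v hv => ⟨hZ v hv, ?_⟩⟩
      rw [hd] at hu hv
      obtain rfl : u = t := hu
      obtain rfl : v = u := hv
      exact hW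
    · exact .inr ⟨ht, ⟨a, ha, hZ⟩, a, ha, u, hu, hW⟩
  · rintro (⟨-, a, ha, hZW⟩ | ⟨ht, ⟨a, ha, hZ⟩, b, hb, u, hu, hW⟩)
    · obtain ⟨u, hu⟩ := (G.trans s a).support_nonempty
      exact ⟨a, ha, fun v hv => (hZW v hv).1, u, hu, (hZW u hu).2⟩
    · have hsp : s ∈ Sₚ := hs.resolve_left fun h => ht (h1 s h).1
      obtain ⟨c, hc⟩ := (hp s hsp).2
      have hab : b = a := by
        rw [hc] at ha hb
        exact hb.trans ha.symm
      exact ⟨a, ha, hZ, u, hab ▸ hu, hW⟩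

variable [Finite S] [Finite A]

theorem IsAlternating.saturated_forallWaitSet (hG : G.IsAlternating turn) {X Y : Set S}
    (hX : Saturated G.posNextEquiv X) (hY : Saturated G.posNextEquiv Y) :
    Saturated G.posNextEquiv (G.forallWaitSet X Y) := by
  have hfb := G.finitelyBranching_of_finite
  have ht : Saturated G.posNextEquiv {s | turn ∈ G.label s} :=
    G.saturated_sem_posNextEquiv (.atom turn) trivial
  refine .iterSup fun B hB => (Saturated.iterSup fun W hW => hX.compl.union (hY.compl.inter ?_)).compl
  rw [hG.almostPre_eq]
  exact (ht.inter (hfb.saturated_pre (hB.compl.inter hW) .one)).union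
    (ht.compl.inter ((hfb.saturated_pre hB.compl .one).inter (hfb.saturated_pre hW .both)))

theorem IsAlternating.saturated_sem_posInterp (hG : G.IsAlternating turn) :
    ∀ f : Formula AP PosQuantifier, Saturated G.posNextEquiv (G.sem G.posInterp f)
  | .tru => .univ
  | .atom q => G.saturated_sem_posNextEquiv (.atom q) trivial
  | .neg f => (hG.saturated_sem_posInterp f).compl
  | .or f g => (hG.saturated_sem_posInterp f).union (hG.saturated_sem_posInterp g)
  | .qState Z f => by
    simp only [sem, posInterp_stateEvent_iff]
    exact hG.saturated_sem_posInterp f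
  | .qNext Z f => by
    rw [sem_qNext]
    exact G.finitelyBranching_of_finite.saturated_pre (hG.saturated_sem_posInterp f) _
  | .qUntil Z f g => by
    simp only [sem, G.posInterp_untilEvent_iff G.finitelyBranching_of_finite]
    exact G.finitelyBranching_of_finite.saturated_untilSet (hG.saturated_sem_posInterp f)
      (hG.saturated_sem_posInterp g) _
  | .qWait .existsPos f g => by
    have hf := hG.saturated_sem_posInterp f
    have hfb := G.finitelyBranching_of_finite
    simp only [sem, posInterp_existsPos_waitEvent_iff]
    exact hfb.saturated_untilSet hf (hf.inter ((hG.saturated_sem_posInterp g).union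
      (hfb.saturated_untilSet .univ hf.compl _).compl)) _
  | .qWait .forallPos f g => by
    simp only [sem, posInterp_forallPos_waitEvent_iff]
    exact hG.saturated_forallWaitSet (hG.saturated_sem_posInterp f) (hG.saturated_sem_posInterp g)

theorem IsAlternating.posNextEquiv_eq_posEquiv (hG : G.IsAlternating turn) :
    G.posNextEquiv = G.posEquiv :=
  Set.Subset.antisymm (fun x h f => hG.saturated_sem_posInterp f x.1 x.2 h)
    G.posEquiv_subset_posNextEquiv

end alternating

end MDP

/-! ### The two counterexamples -/

namespace PMF

variable {α : Type*}

/-- The distribution that gives `x` with probability `p` and `y` otherwise. -/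
def mix (p : ℝ≥0∞) (hp : p ≤ 1) (x y : α) : PMF α :=
  (PMF.ofFintype (fun b : Bool => if b then p else 1 - p) (by simp [hp])).bind
    fun b => PMF.pure (if b then x else y)

theorem tsum_pure_mul (x : α) (v : α → ℝ≥0∞) : ∑' u, PMF.pure x u * v u = v x := by
  rw [tsum_eq_single x fun u hu => by simp [hu]]
  simp

theorem tsum_mix_mul (p : ℝ≥0∞) (hp : p ≤ 1) (x y : α) (v : α → ℝ≥0∞) :
    ∑' u, mix p hp x y u * v u = p * v x + (1 - p) * v y := by
  rw [mix, tsum_bind_mul, tsum_bool, add_comm]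
  simp

theorem support_mix {p : ℝ≥0∞} (hp0 : p ≠ 0) (hp : p < 1) (x y : α) :
    (mix p hp.le x y).support = {x, y} := by
  ext u
  simp [mix, hp0, (tsub_pos_of_lt hp).ne', or_comm]

end PMF

theorem ENNReal.inv_two_lt_one : (2⁻¹ : ℝ≥0∞) < 1 := ENNReal.inv_lt_one.2 ENNReal.one_lt_two

namespace MDP

variable {AP : Type*} (turn : AP)

/-- The formula stating that `turn` is avoided forever with positive probability under every
strategy. -/
def avoidTurn : Formula AP PosQuantifier := .qWait .forallPos (.neg (.atom turn)) (.neg .tru)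

theorem mem_sem_avoidTurn {S A : Type*} [Countable S] (G : MDP AP S A) (s : S) :
    s ∈ G.sem G.posInterp (avoidTurn turn) ↔
      ∀ σ, 0 < G.prob s σ (waitEvent {s | turn ∈ G.label s}ᶜ Set.univᶜ) := Iff.rfl

section race

/-- The probability of absorption at time `n`. -/
def absorbProb : Bool → ℕ → ℝ≥0∞
  | false, _ => 2⁻¹
  | true, n => 2⁻¹ ^ (n + 2)

theorem absorbProb_ne_zero (b : Bool) (n : ℕ) : absorbProb b n ≠ 0 := by
  cases b <;> simp [absorbProb]

theorem absorbProb_lt_one (b : Bool) (n : ℕ) : absorbProb b n < 1 := by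
  cases b
  · exact ENNReal.inv_two_lt_one
  · exact pow_lt_one₀ zero_le ENNReal.inv_two_lt_one (by omega)

/-- Two Markov chains that advance until they are absorbed at `none`: one with a constant
absorption probability, one with summable absorption probabilities. -/
def race : MDP AP (Option (Bool × ℕ)) Unit where
  mov _ := Set.univ
  mov_nonempty _ := Set.univ_nonempty
  trans
    | none, _ => PMF.pure none
    | some (b, n), _ => PMF.mix (absorbProb b n) (absorbProb_lt_one b n).le none (some (b, n + 1))
  label
    | none => {turn}
    | some _ => ∅

theorem dest_race_none (a : Unit) : (race turn).dest none a = {none} := by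
  simp [dest, race]

theorem dest_race_some (b : Bool) (n : ℕ) (a : Unit) :
    (race turn).dest (some (b, n)) a = {none, some (b, n + 1)} :=
  PMF.support_mix (absorbProb_ne_zero b n) (absorbProb_lt_one b n) _ _

theorem finitelyBranching_race : (race turn).FinitelyBranching := by
  rintro (_ | ⟨b, n⟩) a -
  · rw [dest_race_none]
    exact Set.finite_singleton _
  · rw [dest_race_some]
    exact Set.toFinite _

theorem isAlternating_race : (race turn).IsAlternating turn := by
  refine ⟨{none}, {none}ᶜ, Set.union_compl_self _, disjoint_compl_right, ?_, ?_⟩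
  · rintro _ rfl
    exact ⟨Set.mem_singleton turn, fun a _ => ⟨none, dest_race_none turn a⟩⟩
  · rintro (_ | s) hs
    · exact absurd rfl hs
    · exact ⟨Set.notMem_empty turn, (), (Set.eq_univ_of_forall fun _ => rfl).symm⟩

/-- The chains have matching supports step by step, and next-formulas do not see the size of the
probabilities. -/
theorem race_mem_posNextEquiv :
    (some (true, 0), some (false, 0)) ∈ (race turn).posNextEquiv := by
  let R : Set (Option (Bool × ℕ) × Option (Bool × ℕ)) :=
    {x | x.1 = none ∧ x.2 = none ∨ ∃ n, x.1 = some (true, n) ∧ x.2 = some (false, n)}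
  refine (race turn).posNextEquiv_supset (R := R)
    ((race turn).saturated_sem_of_nextOnly ?_ ?_) (.inr ⟨0, rfl, rfl⟩)
  · rintro q s t (⟨rfl, rfl⟩ | ⟨n, rfl, rfl⟩) <;> rfl
  · rintro Q X hX s t (⟨rfl, rfl⟩ | ⟨n, rfl, rfl⟩)
    · rfl
    · have := hX _ _ (.inr ⟨n + 1, rfl, rfl⟩)
      have hm : ∀ s, (race turn).mov s = Set.univ := fun _ => rfl
      cases Q <;> simp [pre, PosQuantifier.toATL, dest_race_some, this, hm]

theorem race_true_mem : some (true, 0) ∈ (race turn).sem (race turn).posInterp (avoidTurn turn) := by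
  rw [mem_sem_avoidTurn]
  intro σ
  -- The absorption probabilities from time `n` on sum to `2⁻¹ ^ (n + 1)`, so survival has at least
  -- the complementary probability.
  let v : Option (Bool × ℕ) → ℝ≥0∞
    | some (true, n) => 1 - 2⁻¹ ^ (n + 1)
    | _ => 0
  have hv : v (some (true, 0)) = 1 - 2⁻¹ ^ (0 + 1) := rfl
  refine lt_of_lt_of_le ?_ ((race turn).le_prob_waitEvent _ σ (v := v) ?_ ?_ ?_)
  · rw [hv]
    simp
  · rintro (_ | ⟨_ | _, n⟩) <;> simp [v]
  · rintro (_ | x) hu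
    · rfl
    · exact absurd (Set.notMem_empty turn) hu
  · intro n h _ _ a _
    rcases h.last with _ | ⟨_ | _, k⟩
    · exact zero_le
    · exact zero_le
    · have hstep := PMF.tsum_mix_mul (absorbProb true k) (absorbProb_lt_one true k).le none
        (some (true, k + 1)) v
      refine le_of_le_of_eq ?_ hstep.symm
      simp only [v, mul_zero, zero_add, absorbProb]
      -- The claim becomes `1 - 2x ≤ (1 - x)²`.
      set x : ℝ≥0∞ := 2⁻¹ ^ (k + 2) with hx
      have hx1 : x ≤ 1 := (absorbProb_lt_one true k).le
      have hx2 : (2⁻¹ : ℝ≥0∞) ^ (k + 1) = x + x := by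
        rw [hx, pow_succ _ (k + 1), ← mul_add, ENNReal.inv_two_add_inv_two, mul_one]
      rw [hx2]
      have hxt : x ≠ ∞ := ne_top_of_le_ne_top ENNReal.one_ne_top hx1
      rw [tsub_le_iff_right]
      calc (1 : ℝ≥0∞) = (1 - x) + x := (tsub_add_cancel_of_le hx1).symm
        _ = (1 - x) * ((1 - x) + x) + x := by
            rw [tsub_add_cancel_of_le hx1, mul_one, tsub_add_cancel_of_le hx1]
        _ = (1 - x) * (1 - x) + (1 - x) * x + x := by rw [mul_add]
        _ ≤ (1 - x) * (1 - x) + x + x := by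
            gcongr
            exact mul_le_of_le_one_left zero_le tsub_le_self
        _ = _ := add_assoc _ _ _

theorem race_false_notMem :
    some (false, 0) ∉ (race turn).sem (race turn).posInterp (avoidTurn turn) := by
  rw [mem_sem_avoidTurn]
  obtain ⟨σ⟩ := (race turn).nonempty_strategy₁
  intro hpos
  -- The value `∞` makes the condition trivial on the other chain, which is never visited.
  let v : Option (Bool × ℕ) → ℝ≥0∞
    | none => 0
    | some (false, _) => 1
    | some (true, _) => ∞
  refine (hpos σ).ne' ((race turn).prob_waitEvent_eq_zero _ σ (v := v) ENNReal.inv_two_lt_one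
    one_ne_zero ?_ ?_ ENNReal.one_ne_top ?_)
  · rintro (_ | ⟨_ | _, n⟩) hu
    · exact absurd rfl hu
    · exact le_rfl
    · exact le_top
  · exact fun u _ h => absurd trivial h
  · intro n h hX a _
    generalize h.last = l at hX ⊢
    rcases l with _ | ⟨_ | _, k⟩
    · exact absurd rfl hX
    · have hstep := PMF.tsum_mix_mul (absorbProb false k) (absorbProb_lt_one false k).le none
        (some (false, k + 1)) v
      refine le_of_eq_of_le hstep ?_
      simp [v, absorbProb]
    · refine le_top.trans_eq (ENNReal.mul_top ?_).symm
      simp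

theorem race_not_subset : ¬ (race turn).posNextEquiv ⊆ (race turn).posEquiv := fun h =>
  race_false_notMem turn ((h (race_mem_posNextEquiv turn) (avoidTurn turn)).1 (race_true_mem turn))

end race

section gamble

/-- The fair distribution on `x` and `y`. -/
def fair {α : Type*} (x y : α) : PMF α := PMF.mix 2⁻¹ ENNReal.inv_two_lt_one.le x y

/-- At the states `(false, _)` one can idle (action `1`) or go to `(true, true)` and `(true, false)`
with probability one half each (action `2`). At `(false, true)` one can also go to `(true, true)`
with probability one half and idle otherwise (action `0`). The states `(true, _)` are absorbing. -/
def gamble : MDP AP (Bool × Bool) (Fin 3) where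
  mov
    | (false, false) => {1, 2}
    | _ => Set.univ
  mov_nonempty s := by rcases s with ⟨_ | _, _ | _⟩ <;> simp
  trans
    | (true, b), _ => PMF.pure (true, b)
    | (false, b), 0 => fair (false, b) (true, true)
    | (false, b), 1 => PMF.pure (false, b)
    | (false, _), 2 => fair (true, true) (true, false)
  label
    | (true, true) => {turn}
    | _ => ∅

theorem support_fair {α : Type*} (x y : α) : (fair x y).support = {x, y} :=
  PMF.support_mix (by simp) ENNReal.inv_two_lt_one x y

theorem tsum_fair_mul {α : Type*} (x y : α) (v : α → ℝ≥0∞) :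
    ∑' u, fair x y u * v u = 2⁻¹ * v x + 2⁻¹ * v y := by
  rw [fair, PMF.tsum_mix_mul, ENNReal.one_sub_inv_two]

theorem not_isAlternating_gamble : ¬ (gamble turn).IsAlternating turn := by
  rintro ⟨S₁, Sₚ, hun, -, h1, hp⟩
  have hs : (false, true) ∈ S₁ ∪ Sₚ := hun ▸ Set.mem_univ _
  rcases hs with hs | hs
  · exact (h1 _ hs).1
  · obtain ⟨a, ha⟩ := (hp _ hs).2
    have h0 : (0 : Fin 3) ∈ (gamble turn).mov (false, true) := trivial
    have h1 : (1 : Fin 3) ∈ (gamble turn).mov (false, true) := trivial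
    rw [ha] at h0 h1
    exact absurd (h0.trans h1.symm) (by decide)

/-- For next-formulas the extra action `0` adds nothing: its destinations are already offered by
actions `1` and `2`, and it can meet `X` whenever idling does. -/
theorem gamble_mem_posNextEquiv :
    ((false, false), (false, true)) ∈ (gamble turn).posNextEquiv := by
  refine (gamble turn).posNextEquiv_supset (R := {((false, false), (false, true))})
    ((gamble turn).saturated_sem_of_nextOnly ?_ ?_) rfl
  · rintro q _ _ ⟨⟩
    rfl
  · rintro Q X hX _ _ ⟨⟩
    have h := hX _ _ rfl
    have d0 : ∀ b, (gamble turn).dest (false, b) 0 = {(false, b), (true, true)} :=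
      fun b => support_fair _ _
    have d1 : ∀ b, (gamble turn).dest (false, b) 1 = {(false, b)} := fun b => PMF.support_pure _
    have d2 : ∀ b, (gamble turn).dest (false, b) 2 = {(true, true), (true, false)} :=
      fun b => support_fair _ _
    have mf : (gamble turn).mov (false, false) = {1, 2} := rfl
    have mt : (gamble turn).mov (false, true) = Set.univ := rfl
    cases Q
    · simp [pre, PosQuantifier.toATL, mf, mt, Fin.exists_fin_succ, d0, d1, d2, h]
      tauto
    · simp [pre, PosQuantifier.toATL, mf, mt, Fin.forall_fin_succ, d0, d1, d2, h]
      tauto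

/-- Idling avoids `turn`, and the only way out, action `2`, ends in `(true, false)` with probability
one half. -/
theorem gamble_false_mem :
    (false, false) ∈ (gamble turn).sem (gamble turn).posInterp (avoidTurn turn) := by
  rw [mem_sem_avoidTurn]
  intro σ
  let v : Bool × Bool → ℝ≥0∞
    | (false, false) => 2⁻¹
    | (true, false) => 1
    | _ => 0
  have hv : (0 : ℝ≥0∞) < v (false, false) := by simp [v]
  refine hv.trans_le ((gamble turn).le_prob_waitEvent _ σ (v := v) ?_ ?_ ?_)
  · rintro ⟨_ | _, _ | _⟩ <;> simp [v, ENNReal.inv_two_lt_one.le]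
  · rintro ⟨_ | _, _ | _⟩ hu
    · exact absurd (Set.notMem_empty turn) hu
    · rfl
    · exact absurd (Set.notMem_empty turn) hu
    · rfl
  · intro n h _ _ a ha
    have ham := σ.support_subset n h ha
    generalize h.last = l at ham ⊢
    rcases l with ⟨_ | _, _ | _⟩
    · rcases ham with rfl | rfl
      · exact (PMF.tsum_pure_mul _ v).ge
      · refine le_of_le_of_eq ?_ (tsum_fair_mul _ _ v).symm
        simp [v]
    · exact zero_le
    · exact (PMF.tsum_pure_mul _ v).ge
    · exact zero_le

/-- Repeating action `0` reaches `turn` almost surely, as each attempt succeeds with probability one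
half. -/
theorem gamble_true_notMem :
    (false, true) ∉ (gamble turn).sem (gamble turn).posInterp (avoidTurn turn) := by
  rw [mem_sem_avoidTurn]
  intro hpos
  let v : Bool × Bool → ℝ≥0∞
    | (false, true) => 1
    | (true, true) => 0
    | _ => ∞
  -- Action `0` is not available at `(false, false)`, so the strategy needs another value there.
  let f : Bool × Bool → Fin 3
    | (false, false) => 1
    | _ => 0
  let σ : (gamble turn).Strategy₁ := .ofAction _ f fun s => by
    rcases s with ⟨_ | _, _ | _⟩ <;> simp [gamble, f]
  refine (hpos σ).ne' ((gamble turn).prob_waitEvent_eq_zero _ σ (v := v) ENNReal.inv_two_lt_one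
    one_ne_zero ?_ ?_ ENNReal.one_ne_top ?_)
  · rintro ⟨_ | _, _ | _⟩ hu
    · exact le_top
    · exact le_rfl
    · exact le_top
    · exact absurd rfl hu
  · exact fun u _ h => absurd trivial h
  · intro n h hX a ha
    have ha' : a = f h.last := by simpa [σ, Strategy₁.ofAction] using ha
    subst ha'
    clear ha
    have htop : (∞ : ℝ≥0∞) = 2⁻¹ * ∞ := (ENNReal.mul_top (by simp)).symm
    generalize h.last = l at hX ⊢
    rcases l with ⟨_ | _, _ | _⟩
    · exact le_top.trans_eq htop
    · refine le_of_eq_of_le (tsum_fair_mul _ _ v) ?_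
      simp [v]
    · exact le_top.trans_eq htop
    · exact absurd rfl hX

theorem gamble_not_subset : ¬ (gamble turn).posNextEquiv ⊆ (gamble turn).posEquiv := fun h =>
  gamble_true_notMem turn
    ((h (gamble_mem_posNextEquiv turn) (avoidTurn turn)).1 (gamble_false_mem turn))

end gamble

end MDP

end

theorem mainTheorem8 {AP : Type*} (turn : AP) :
    (∀ (S : Type*) (A : Type*) [Countable S] [Finite A] (G : MDP AP S A),
      G.FinitelyBranching → G.posNextEquiv = G.atlEquiv) ∧
    (∀ (S : Type*) (A : Type*) [Countable S] [Finite A] (G : MDP AP S A),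
      G.posEquiv ⊆ G.posNextEquiv) ∧
    (∀ (S : Type*) (A : Type*) [Finite S] [Finite A] (G : MDP AP S A),
      G.IsAlternating turn → G.posNextEquiv = G.posEquiv) ∧
    (∃ (S A : Type) (_ : Countable S) (_ : Finite A) (G : MDP AP S A),
      Infinite S ∧ G.FinitelyBranching ∧ G.IsAlternating turn ∧
        ¬ G.posNextEquiv ⊆ G.posEquiv) ∧
    (∃ (S A : Type) (_ : Finite S) (_ : Finite A) (G : MDP AP S A),
      ¬ G.IsAlternating turn ∧ ¬ G.posNextEquiv ⊆ G.posEquiv) := by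
  refine ⟨fun S A _ _ G hG => hG.posNextEquiv_eq_atlEquiv,
    fun S A _ _ G => G.posEquiv_subset_posNextEquiv,
    fun S A _ _ G hG => hG.posNextEquiv_eq_posEquiv,
    ⟨_, _, inferInstance, inferInstance, MDP.race turn, inferInstance,
      MDP.finitelyBranching_race turn, MDP.isAlternating_race turn, MDP.race_not_subset turn⟩,
    ⟨_, _, inferInstance, inferInstance, MDP.gamble turn, MDP.not_isAlternating_gamble turn,
      MDP.gamble_not_subset turn⟩⟩
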